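/- Let $H_1,G_1$ be Hilbert spaces over $\mathbb K\in\{\mathbb R,\mathbb C\}$ and $S_1\colon H_1\to G_1$ a compact linear operator. Let $\lambda=(\lambda_m)_{m\in\mathbb N}$, $\lambda_1\ge\lambda_2\ge\dots\ge 0$, be the sequence of its squared singular values, i.e. the eigenvalues of $S_1^\dagger S_1$ counted with multiplicity (continued by zeros if only finitely many are positive), and assume $\lambda_2>0$. For $d\in\mathbb N=\{1,2,\dots\}$ let $H_d=H_1\otimes\dots\otimes H_1$ and $G_d=G_1\otimes\dots\otimes G_1$ be the $d$-fold Hilbert space tensor products and let $S_d=S_1\otimes\dots\otimes S_1\colon H_d\to G_d$. For a permutation $\pi$ of $\{1,\dots,d\}$ let $U_\pi$ be the unitary operator on $H_d$ with $U_\pi(f_1\otimes\dots\otimes f_d)=f_{\pi(1)}\otimes\dots\otimes f_{\pi(d)}$. The fully symmetric problem is the restriction of $S_d$ to $F_d=\{f\in H_d: f=U_\pi f\text{ for all }\pi\}$, and the fully antisymmetric problem is the restriction of $S_d$ to $F_d=\{f\in H_d: f=\operatorname{sgn}(\pi)\,U_\pi f\text{ for all }\pi\}$. For such a problem $S_d\colon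 F_d\to G_d$ let $$e(n,d)=\inf_{A}\ \sup_{f\in F_d,\ \|f\|\le 1}\|A f-S_d f\|_{G_d},\qquad n\in\mathbb N_0,$$ where the infimum is over all algorithms $A\colon F_d\to G_d$ that use $n$ continuous linear functionals. (The statement holds both for the class of linear algorithms $Af=\sum_{v=1}^n L_v(f)\,g_v$ with $L_v\in F_d^*$, $g_v\in G_d$, and for the class of algorithms $Af=\phi(y_1,\dots,y_n)$ with arbitrary $\phi\colon\mathbb K^n\to G_d$ and adaptive information $y_v=L_v(f;y_1,\dots,y_{v-1})$, $L_v(\,\cdot\,;y_1,\dots,y_{v-1})\in F_d^*$.) Let $\epsilon_d^{\rm init}=e(0,d)$ and $n(\epsilon,d)=\min\{n\in\mathbb N_0: e(n,d)\le\epsilon\}$. The problem is called strongly polynomially tractable with respect to the absolute error criterion if there are constants $C,p>0$ with $n(\epsilon,d)\le C\,\epsilon^{-p}$ for all $d\in\mathbb N$ and all $\epsilon\in(0,1]$, and with respect to the normalized error criterion if there are $C,p>0$ with $n(\epsilon\cdot\epsilon_d^{\rm init},d)\le C\,\epsilon^{-p}$ for all $d\in\mathbb N$ and all $\epsilon\in(0,1]$.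 Theorem. Under these assumptions: 1. The fully symmetric problem is strongly polynomially tractable with respect to the normalized error criterion if and only if $\lambda\in\ell_\tau$ for some $\tau\in(0,\infty)$ and $\lambda_1>\lambda_2$. 2. If $\lambda_1\le 1$, then the fully symmetric problem is strongly polynomially tractable with respect to the absolute error criterion if and only if $\lambda\in\ell_\tau$ for some $\tau\in(0,\infty)$ and $\lambda_2<1$. 3. The fully antisymmetric problem is strongly polynomially tractable with respect to the absolute error criterion if and only if $\lambda\in\ell_\tau$ for some $\tau\in(0,\infty)$. -/

import Mathlib

open scoped TensorProduct ENNReal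

noncomputable section

namespace SymTensor

/-! ### The algebraic tensor power with its inner product -/

/-- The algebraic `d`-fold tensor power `H ⊗ ⋯ ⊗ H`, as a type of its own because the norm used here
is not the projective one that Mathlib puts on `⨂[𝕜] i, E i`. -/
def AlgPower (𝕜 : Type*) [RCLike 𝕜] (H : Type*) [NormedAddCommGroup H] [InnerProductSpace 𝕜 H]
    (d : ℕ) : Type _ :=
  ⨂[𝕜] _ : Fin d, H

section Algebraic

variable {𝕜 : Type*} [RCLike 𝕜] {H : Type*} [NormedAddCommGroup H] [InnerProductSpace 𝕜 H]
variable {G : Type*} [NormedAddCommGroup G] [InnerProductSpace 𝕜 G] {d : ℕ}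

instance : AddCommGroup (AlgPower 𝕜 H d) := inferInstanceAs (AddCommGroup (⨂[𝕜] _ : Fin d, H))

instance : Module 𝕜 (AlgPower 𝕜 H d) := inferInstanceAs (Module 𝕜 (⨂[𝕜] _ : Fin d, H))

/-- The simple tensor `f₁ ⊗ ⋯ ⊗ f_d` in the algebraic tensor power. -/
def algPure (𝕜 : Type*) [RCLike 𝕜] {H : Type*} [NormedAddCommGroup H] [InnerProductSpace 𝕜 H]
    {d : ℕ} : MultilinearMap 𝕜 (fun _ : Fin d => H) (AlgPower 𝕜 H d) :=
  PiTensorProduct.tprod 𝕜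

theorem alg_induction {p : AlgPower 𝕜 H d → Prop} (x : AlgPower 𝕜 H d)
    (h₁ : ∀ (r : 𝕜) (f : Fin d → H), p (r • algPure 𝕜 f))
    (h₂ : ∀ x y, p x → p y → p (x + y)) : p x :=
  PiTensorProduct.induction_on x h₁ h₂

/-- The linear map `⟨f₁ ⊗ ⋯ ⊗ f_d, ·⟩`. -/
def pairingLeft (f : Fin d → H) : AlgPower 𝕜 H d →ₗ[𝕜] 𝕜 :=
  PiTensorProduct.lift
    ((MultilinearMap.mkPiAlgebra 𝕜 (Fin d) 𝕜).compLinearMap (fun l => innerₛₗ 𝕜 (f l)))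

theorem pairingLeft_pure (f g : Fin d → H) :
    pairingLeft f (algPure 𝕜 g) = ∏ l, inner 𝕜 (f l) (g l) := by
  refine (PiTensorProduct.lift.tprod g).trans ?_
  simp

theorem alg_hom_ext {φ ψ : AlgPower 𝕜 H d →ₗ[𝕜] 𝕜}
    (h : ∀ g, φ (algPure 𝕜 g) = ψ (algPure 𝕜 g)) : φ = ψ :=
  PiTensorProduct.ext (MultilinearMap.ext h)

/-- The sesquilinear pairing of the tensor power. -/
def pairing : AlgPower 𝕜 H d →+ (AlgPower 𝕜 H d →ₗ[𝕜] 𝕜) :=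
  PiTensorProduct.liftAddHom (fun p => (starRingEnd 𝕜) p.1 • pairingLeft p.2)
    (by
      intro r f i hf
      refine alg_hom_ext fun g => ?_
      simp only [LinearMap.smul_apply, pairingLeft_pure, LinearMap.zero_apply]
      rw [Finset.prod_eq_zero (Finset.mem_univ i) (by simp [hf]), smul_zero])
    (by intro f; simp)
    (by
      intro _ r f i m₁ m₂
      refine alg_hom_ext fun g => ?_
      simp only [LinearMap.smul_apply, LinearMap.add_apply, pairingLeft_pure]
      rw [← smul_add]
      congr 1
      have key : ∀ m, ∏ l, inner 𝕜 (Function.update f i m l) (g l)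
          = inner 𝕜 m (g i) * ∏ l ∈ Finset.univ.erase i, inner 𝕜 (f l) (g l) := by
        intro m
        rw [← Finset.mul_prod_erase _ _ (Finset.mem_univ i)]
        congr 1
        · simp
        · refine Finset.prod_congr rfl fun l hl => ?_
          rw [Function.update_of_ne (Finset.ne_of_mem_erase hl)]
      rw [key, key, key, inner_add_left, add_mul])
    (by intro r r' f; rw [map_add, add_smul])
    (by
      intro _ r f i r'
      refine alg_hom_ext fun g => ?_
      simp only [LinearMap.smul_apply, pairingLeft_pure, map_mul, smul_eq_mul]
      rw [← Finset.mul_prod_erase _ _ (Finset.mem_univ i),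
        ← Finset.mul_prod_erase _ (fun l => inner 𝕜 (f l) (g l)) (Finset.mem_univ i)]
      rw [Finset.prod_congr rfl fun l hl => by
        rw [Function.update_of_ne (Finset.ne_of_mem_erase hl)]]
      simp only [Function.update_self, inner_smul_left]
      ring)

theorem pairing_smul_pure (r : 𝕜) (f : Fin d → H) :
    pairing (r • algPure 𝕜 f) = (starRingEnd 𝕜) r • pairingLeft f := by
  have h : (r • algPure 𝕜 f : AlgPower 𝕜 H d) = PiTensorProduct.tprodCoeff 𝕜 r f :=
    (PiTensorProduct.tprodCoeff_eq_smul_tprod r f).symm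
  rw [h]
  rfl

theorem pairing_pure_pure (f g : Fin d → H) :
    pairing (algPure 𝕜 f) (algPure 𝕜 g) = ∏ l, inner 𝕜 (f l) (g l) := by
  have h := pairing_smul_pure (1 : 𝕜) f
  rw [one_smul, map_one, one_smul] at h
  rw [h, pairingLeft_pure]

theorem pairing_smul (r : 𝕜) (x : AlgPower 𝕜 H d) :
    pairing (r • x) = (starRingEnd 𝕜) r • pairing x := by
  induction x using alg_induction with
  | h₁ s f => rw [smul_smul, pairing_smul_pure, pairing_smul_pure, smul_smul, map_mul]
  | h₂ x y hx hy => rw [smul_add, map_add, map_add, hx, hy, smul_add]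

theorem pairing_conj_symm (x y : AlgPower 𝕜 H d) :
    (starRingEnd 𝕜) (pairing y x) = pairing x y := by
  induction x using alg_induction with
  | h₂ x x' hx hx' => rw [map_add, map_add, hx, hx', map_add, LinearMap.add_apply]
  | h₁ r f =>
    induction y using alg_induction with
    | h₂ y y' hy hy' => rw [map_add, map_add, LinearMap.add_apply, map_add, hy, hy']
    | h₁ s g =>
      rw [LinearMap.map_smul, LinearMap.map_smul, pairing_smul, pairing_smul, LinearMap.smul_apply,
        LinearMap.smul_apply, pairing_pure_pure, pairing_pure_pure]
      simp only [smul_eq_mul, map_mul, map_prod, inner_conj_symm, RCLike.conj_conj]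
      ring

theorem exists_finite_support (x : AlgPower 𝕜 H d) :
    ∃ W : Submodule 𝕜 H, FiniteDimensional 𝕜 W ∧
      x ∈ Submodule.span 𝕜 (algPure 𝕜 '' {f : Fin d → H | ∀ l, f l ∈ W}) := by
  induction x using alg_induction with
  | h₁ r f =>
    refine ⟨Submodule.span 𝕜 (Set.range f), FiniteDimensional.span_of_finite 𝕜 (Set.finite_range f),
      Submodule.smul_mem _ _ (Submodule.subset_span ⟨f, fun l => ?_, rfl⟩)⟩
    exact Submodule.subset_span ⟨l, rfl⟩
  | h₂ x y hx hy =>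
    obtain ⟨W, hW, hx⟩ := hx
    obtain ⟨W', hW', hy⟩ := hy
    refine ⟨W ⊔ W', inferInstance, Submodule.add_mem _ ?_ ?_⟩
    · refine Submodule.span_mono ?_ hx
      rintro _ ⟨f, hf, rfl⟩
      exact ⟨f, fun l => Submodule.mem_sup_left (hf l), rfl⟩
    · refine Submodule.span_mono ?_ hy
      rintro _ ⟨f, hf, rfl⟩
      exact ⟨f, fun l => Submodule.mem_sup_right (hf l), rfl⟩

/-- Every algebraic tensor has a finite expansion in a tensor product basis that consists of
right singular vectors of a given operator (restricted to a finite dimensional subspace). -/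
theorem exists_expansion [CompleteSpace G] (T : H →L[𝕜] G) (x : AlgPower 𝕜 H d) :
    ∃ (n : ℕ) (b : Fin n → H) (c : (Fin d → Fin n) → 𝕜), Orthonormal 𝕜 b ∧
      (∀ i j, i ≠ j → inner 𝕜 (T (b i)) (T (b j)) = 0) ∧
      x = ∑ k, c k • algPure 𝕜 (fun l => b (k l)) := by
  obtain ⟨W, hW, hx⟩ := exists_finite_support x
  let R : W →L[𝕜] G := T ∘L W.subtypeL
  let A : W →L[𝕜] W := (ContinuousLinearMap.adjoint R) ∘L R
  have hA : (A : W →ₗ[𝕜] W).IsSymmetric := by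
    intro u v
    simp [A, ContinuousLinearMap.adjoint_inner_left, ContinuousLinearMap.adjoint_inner_right]
  let b := hA.eigenvectorBasis (n := Module.finrank 𝕜 W) rfl
  refine ⟨Module.finrank 𝕜 W, fun i => (b i : H), ?_⟩
  have hb : Orthonormal 𝕜 (fun i => (b i : H)) :=
    b.orthonormal.comp_linearIsometry W.subtypeₗᵢ
  have hspan : x ∈ Submodule.span 𝕜 (Set.range fun k : Fin d → Fin (Module.finrank 𝕜 W) =>
      algPure 𝕜 (fun l => (b (k l) : H))) := by
    refine Submodule.span_le.2 ?_ hx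
    rintro _ ⟨f, hf, rfl⟩
    have hf' : f = fun l => ∑ i, b.repr ⟨f l, hf l⟩ i • (b i : H) := by
      funext l
      have := congrArg (Subtype.val) (b.sum_repr ⟨f l, hf l⟩)
      simpa using this.symm
    rw [hf']
    simp only [SetLike.mem_coe]
    rw [MultilinearMap.map_sum]
    refine Submodule.sum_mem _ fun k _ => ?_
    rw [MultilinearMap.map_smul_univ]
    exact Submodule.smul_mem _ _ (Submodule.subset_span ⟨k, rfl⟩)
  obtain ⟨c, hc⟩ := (Submodule.mem_span_range_iff_exists_fun 𝕜).1 hspan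
  refine ⟨c, hb, ?_, hc.symm⟩
  intro i j hij
  have h1 : inner 𝕜 (T (b i)) (T (b j)) = inner 𝕜 (A (b i)) (b j) := by
    simp [A, R, ContinuousLinearMap.adjoint_inner_left]
  rw [h1]
  have h2 : A (b i) = ((hA.eigenvalues rfl i : ℝ) : 𝕜) • b i := hA.apply_eigenvectorBasis rfl i
  rw [h2, inner_smul_left, b.inner_eq_zero hij, mul_zero]

theorem pairing_sum_self {n : ℕ} (b : Fin n → H)
    (hb : ∀ i j, i ≠ j → inner 𝕜 (b i) (b j) = 0) (c : (Fin d → Fin n) → 𝕜) :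
    pairing (∑ k, c k • algPure 𝕜 (fun l => b (k l))) (∑ k, c k • algPure 𝕜 (fun l => b (k l)))
      = ((∑ k, ‖c k‖ ^ 2 * ∏ l, ‖b (k l)‖ ^ 2 : ℝ) : 𝕜) := by
  rw [map_sum pairing, LinearMap.sum_apply, RCLike.ofReal_sum]
  refine Finset.sum_congr rfl fun k _ => ?_
  rw [map_sum, Finset.sum_eq_single k]
  · rw [map_smul, pairing_smul, LinearMap.smul_apply, pairing_pure_pure]
    simp only [inner_self_eq_norm_sq_to_K, smul_eq_mul]
    push_cast
    rw [← mul_assoc, RCLike.mul_conj]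
  · intro m _ hm
    rw [map_smul, pairing_smul, LinearMap.smul_apply, pairing_pure_pure]
    obtain ⟨l, hl⟩ := Function.ne_iff.1 hm
    rw [Finset.prod_eq_zero (Finset.mem_univ l) (hb _ _ hl.symm), smul_zero, smul_zero]
  · simp

/-- The inner product of the algebraic tensor power, determined by
`⟨f₁ ⊗ ⋯ ⊗ f_d, g₁ ⊗ ⋯ ⊗ g_d⟩ = ∏ l, ⟨f_l, g_l⟩`. -/
abbrev algCore : InnerProductSpace.Core 𝕜 (AlgPower 𝕜 H d) where
  inner x y := pairing x y
  conj_inner_symm x y := pairing_conj_symm x y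
  re_inner_nonneg x := by
    obtain ⟨n, b, c, hb, -, rfl⟩ := exists_expansion (0 : H →L[𝕜] 𝕜) x
    rw [pairing_sum_self b (fun i j h => hb.2 h), RCLike.ofReal_re]
    positivity
  add_left x y z := by rw [map_add, LinearMap.add_apply]
  smul_left x y r := by rw [pairing_smul, LinearMap.smul_apply, smul_eq_mul]
  definite x hx := by
    obtain ⟨n, b, c, hb, -, rfl⟩ := exists_expansion (0 : H →L[𝕜] 𝕜) x
    rw [pairing_sum_self b (fun i j h => hb.2 h), RCLike.ofReal_eq_zero,
      Finset.sum_eq_zero_iff_of_nonneg (fun _ _ => by positivity)] at hx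
    refine Finset.sum_eq_zero fun k hk => ?_
    have h := hx k hk
    simp only [hb.1, one_pow, Finset.prod_const_one, mul_one] at h
    rw [norm_eq_zero.1 (pow_eq_zero_iff two_ne_zero |>.1 h), zero_smul]

instance : NormedAddCommGroup (AlgPower 𝕜 H d) := (algCore (𝕜 := 𝕜)).toNormedAddCommGroup

instance : InnerProductSpace 𝕜 (AlgPower 𝕜 H d) := .ofCore _

theorem inner_eq_pairing (x y : AlgPower 𝕜 H d) : inner 𝕜 x y = pairing x y := rfl

theorem inner_algPure (f g : Fin d → H) :
    inner 𝕜 (algPure 𝕜 f) (algPure 𝕜 g) = ∏ l, inner 𝕜 (f l) (g l) :=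
  pairing_pure_pure f g

theorem norm_sum_sq {n : ℕ} (b : Fin n → H)
    (hb : ∀ i j, i ≠ j → inner 𝕜 (b i) (b j) = 0) (c : (Fin d → Fin n) → 𝕜) :
    ‖∑ k, c k • algPure 𝕜 (fun l => b (k l))‖ ^ 2 = ∑ k, ‖c k‖ ^ 2 * ∏ l, ‖b (k l)‖ ^ 2 := by
  rw [← inner_self_eq_norm_sq (𝕜 := 𝕜), inner_eq_pairing, pairing_sum_self b hb, RCLike.ofReal_re]

/-- The algebraic tensor power `T ⊗ ⋯ ⊗ T`. -/
def algMap (T : H →L[𝕜] G) (d : ℕ) : AlgPower 𝕜 H d →ₗ[𝕜] AlgPower 𝕜 G d :=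
  PiTensorProduct.map (fun _ => (T : H →ₗ[𝕜] G))

theorem algMap_pure (T : H →L[𝕜] G) (f : Fin d → H) :
    algMap T d (algPure 𝕜 f) = algPure 𝕜 (fun l => T (f l)) :=
  PiTensorProduct.map_tprod _ _

theorem norm_algMap_le [CompleteSpace G] (T : H →L[𝕜] G) (x : AlgPower 𝕜 H d) :
    ‖algMap T d x‖ ≤ ‖T‖ ^ d * ‖x‖ := by
  obtain ⟨n, b, c, hb, hT, rfl⟩ := exists_expansion T x
  refine le_of_sq_le_sq ?_ (by positivity)
  simp only [map_sum, map_smul, algMap_pure]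
  rw [norm_sum_sq (fun i => T (b i)) hT, mul_pow, norm_sum_sq b (fun i j h => hb.2 h),
    Finset.mul_sum]
  refine Finset.sum_le_sum fun k _ => ?_
  simp only [hb.1, one_pow, Finset.prod_const_one, mul_one]
  rw [mul_comm]
  refine mul_le_mul_of_nonneg_right ?_ (by positivity)
  calc ∏ l, ‖T (b (k l))‖ ^ 2 ≤ ∏ _l : Fin d, ‖T‖ ^ 2 := by
        refine Finset.prod_le_prod (fun _ _ => by positivity) fun l _ => ?_
        refine pow_le_pow_left₀ (norm_nonneg _) ?_ 2
        simpa [hb.1] using T.le_opNorm (b (k l))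
    _ = (‖T‖ ^ d) ^ 2 := by simp [← pow_mul, mul_comm]

/-- The permutation of the tensor factors,
`f₁ ⊗ ⋯ ⊗ f_d ↦ f_{π(1)} ⊗ ⋯ ⊗ f_{π(d)}`. -/
def algPerm (π : Equiv.Perm (Fin d)) : AlgPower 𝕜 H d →ₗ[𝕜] AlgPower 𝕜 H d :=
  (PiTensorProduct.reindex 𝕜 (fun _ : Fin d => H) π.symm).toLinearMap

theorem algPerm_pure (π : Equiv.Perm (Fin d)) (f : Fin d → H) :
    algPerm π (algPure 𝕜 f) = algPure 𝕜 (fun l => f (π l)) :=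
  PiTensorProduct.reindex_tprod _ _

theorem inner_algPerm (π : Equiv.Perm (Fin d)) (x y : AlgPower 𝕜 H d) :
    inner 𝕜 (algPerm π x) (algPerm π y) = inner 𝕜 x y := by
  induction x using alg_induction with
  | h₂ x x' hx hx' => rw [map_add, inner_add_left, inner_add_left, hx, hx']
  | h₁ r f =>
    induction y using alg_induction with
    | h₂ y y' hy hy' => rw [map_add, inner_add_right, inner_add_right, hy, hy']
    | h₁ s g =>
      simp only [map_smul, algPerm_pure, inner_smul_left, inner_smul_right, inner_algPure]
      rw [Equiv.prod_comp π (fun l => inner 𝕜 (f l) (g l))]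

theorem norm_algPerm (π : Equiv.Perm (Fin d)) (x : AlgPower 𝕜 H d) : ‖algPerm π x‖ = ‖x‖ := by
  rw [norm_eq_sqrt_re_inner (𝕜 := 𝕜), inner_algPerm, ← norm_eq_sqrt_re_inner]

end Algebraic

/-! ### The Hilbert space tensor power, tensor power operators, (anti-)symmetric subspaces -/

/-- The `d`-fold Hilbert space tensor power `H_d = H ⊗ ⋯ ⊗ H`. -/
abbrev HilbertPower (𝕜 : Type*) [RCLike 𝕜] (H : Type*) [NormedAddCommGroup H]
    [InnerProductSpace 𝕜 H] (d : ℕ) : Type _ :=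
  UniformSpace.Completion (AlgPower 𝕜 H d)

section Hilbert

variable {𝕜 : Type*} [RCLike 𝕜] {H : Type*} [NormedAddCommGroup H] [InnerProductSpace 𝕜 H]
variable {G : Type*} [NormedAddCommGroup G] [InnerProductSpace 𝕜 G] {d : ℕ}

/-- The simple tensor `f₁ ⊗ ⋯ ⊗ f_d` in the Hilbert space tensor power. -/
def pureTensor (𝕜 : Type*) [RCLike 𝕜] {H : Type*} [NormedAddCommGroup H] [InnerProductSpace 𝕜 H]
    {d : ℕ} (f : Fin d → H) : HilbertPower 𝕜 H d :=
  (algPure 𝕜 f : AlgPower 𝕜 H d)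

theorem inner_pureTensor (f g : Fin d → H) :
    inner 𝕜 (pureTensor 𝕜 f) (pureTensor 𝕜 g) = ∏ l, inner 𝕜 (f l) (g l) :=
  (UniformSpace.Completion.inner_coe _ _).trans (inner_algPure f g)

/-- The continuous linear extension to the completions of a bounded linear map. -/
def extendCompl {E F : Type*} [NormedAddCommGroup E] [NormedSpace 𝕜 E] [NormedAddCommGroup F]
    [NormedSpace 𝕜 F] (T : E →L[𝕜] F) :
    UniformSpace.Completion E →L[𝕜] UniformSpace.Completion F :=
  (UniformSpace.Completion.toComplL ∘L T).extend
    (UniformSpace.Completion.toComplL : E →L[𝕜] UniformSpace.Completion E)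

theorem extendCompl_coe {E F : Type*} [NormedAddCommGroup E] [NormedSpace 𝕜 E]
    [NormedAddCommGroup F] [NormedSpace 𝕜 F] (T : E →L[𝕜] F) (x : E) :
    extendCompl T (x : UniformSpace.Completion E) = (T x : UniformSpace.Completion F) :=
  ContinuousLinearMap.extend_eq _ UniformSpace.Completion.denseRange_coe
    (UniformSpace.Completion.isUniformInducing_coe E) x

/-- The tensor power operator `S_d = S ⊗ ⋯ ⊗ S : H_d → G_d`. -/
def powerOperator [CompleteSpace G] (S : H →L[𝕜] G) (d : ℕ) :
    HilbertPower 𝕜 H d →L[𝕜] HilbertPower 𝕜 G d :=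
  extendCompl ((algMap S d).mkContinuous (‖S‖ ^ d) (norm_algMap_le S))

theorem powerOperator_pureTensor [CompleteSpace G] (S : H →L[𝕜] G) (f : Fin d → H) :
    powerOperator S d (pureTensor 𝕜 f) = pureTensor 𝕜 (fun l => S (f l)) :=
  (extendCompl_coe _ _).trans (congrArg _ (algMap_pure S f))

/-- The action of a permutation of the `d` factors on `H_d`. If `H` is a space of functions on `D`,
it is `f ↦ f ∘ σ` with `σ` the permutation of the `d` arguments that is inverse to `π`. -/
def permute (π : Equiv.Perm (Fin d)) : HilbertPower 𝕜 H d →L[𝕜] HilbertPower 𝕜 H d :=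
  extendCompl ((algPerm π).mkContinuous 1 (fun x => by rw [norm_algPerm, one_mul]))

theorem permute_pureTensor (π : Equiv.Perm (Fin d)) (f : Fin d → H) :
    permute π (pureTensor 𝕜 f) = pureTensor 𝕜 (fun l => f (π l)) :=
  (extendCompl_coe _ _).trans (congrArg _ (algPerm_pure π f))

/-- The subspace of the fully symmetric elements of `H_d`. -/
def symmetricSubspace (𝕜 : Type*) [RCLike 𝕜] (H : Type*) [NormedAddCommGroup H]
    [InnerProductSpace 𝕜 H] (d : ℕ) : Submodule 𝕜 (HilbertPower 𝕜 H d) where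
  carrier := {f | ∀ π : Equiv.Perm (Fin d), f = permute π f}
  add_mem' hf hg π := by rw [map_add, ← hf π, ← hg π]
  zero_mem' π := by rw [map_zero]
  smul_mem' c f hf π := by rw [map_smul, ← hf π]

/-- The subspace of the fully antisymmetric elements of `H_d`. -/
def antisymmetricSubspace (𝕜 : Type*) [RCLike 𝕜] (H : Type*) [NormedAddCommGroup H]
    [InnerProductSpace 𝕜 H] (d : ℕ) : Submodule 𝕜 (HilbertPower 𝕜 H d) where
  carrier := {f | ∀ π : Equiv.Perm (Fin d), f = ((Equiv.Perm.sign π : ℤ) : 𝕜) • permute π f}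
  add_mem' hf hg π := by rw [map_add, smul_add, ← hf π, ← hg π]
  zero_mem' π := by rw [map_zero, smul_zero]
  smul_mem' c f hf π := by rw [map_smul, smul_comm, ← hf π]

/-- The fully symmetric problem: `S_d` restricted to the fully symmetric elements. -/
def symmetricProblem [CompleteSpace G] (S : H →L[𝕜] G) (d : ℕ) :
    symmetricSubspace 𝕜 H d →L[𝕜] HilbertPower 𝕜 G d :=
  powerOperator S d ∘L (symmetricSubspace 𝕜 H d).subtypeL

/-- The fully antisymmetric problem: `S_d` restricted to the fully antisymmetric elements. -/
def antisymmetricProblem [CompleteSpace G] (S : H →L[𝕜] G) (d : ℕ) :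
    antisymmetricSubspace 𝕜 H d →L[𝕜] HilbertPower 𝕜 G d :=
  powerOperator S d ∘L (antisymmetricSubspace 𝕜 H d).subtypeL

/-- `lam 0 ≥ lam 1 ≥ …` is the sequence of the squared singular values of the compact operator `S`,
i.e. of the eigenvalues of `S† S` counted with multiplicity and, if only finitely many of them are
positive, continued by zeros: there are orthonormal eigenvectors for the positive terms, and `S`
vanishes on the orthogonal complement of these eigenvectors. -/
structure IsSquaredSingularValues [CompleteSpace H] [CompleteSpace G] (S : H →L[𝕜] G)
    (lam : ℕ → ℝ) : Prop where
  antitone : Antitone lam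
  nonneg : ∀ m, 0 ≤ lam m
  exists_eigenvectors : ∃ e : {m : ℕ // 0 < lam m} → H, Orthonormal 𝕜 e ∧
    (∀ m, ContinuousLinearMap.adjoint S (S (e m)) = (lam m : 𝕜) • e m) ∧
    ∀ x, (∀ m, inner 𝕜 (e m) x = 0) → S x = 0

end Hilbert

/-! ### Algorithms, information complexity, strong polynomial tractability -/

/-- The two classes of algorithms: linear algorithms that use nonadaptive linear information, and
arbitrary algorithms that use adaptive linear information. -/
inductive AlgorithmClass
  | linear
  | adaptive

section Complexity

variable {𝕜 : Type*} [RCLike 𝕜] {F : Type*} [NormedAddCommGroup F] [NormedSpace 𝕜 F]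
variable {Y : Type*} [NormedAddCommGroup Y] [NormedSpace 𝕜 Y]

/-- `A` is of the form `A f = ∑ v, L_v(f) g_v` with `n` continuous linear functionals `L_v`. -/
def IsLinearAlgorithm (𝕜 : Type*) [RCLike 𝕜] {F : Type*} [NormedAddCommGroup F] [NormedSpace 𝕜 F]
    {Y : Type*} [NormedAddCommGroup Y] [NormedSpace 𝕜 Y] (n : ℕ) (A : F → Y) : Prop :=
  ∃ (L : Fin n → (F →L[𝕜] 𝕜)) (g : Fin n → Y), ∀ f, A f = ∑ v, L v f • g v

/-- `A = φ ∘ N` with an arbitrary `φ` and an information map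
`N f = (y₁, …, y_n)`, `y_v = L_v(f; y₁, …, y_{v-1})`, where each `L_v(· ; y₁, …, y_{v-1})` is a
continuous linear functional. -/
def IsAdaptiveAlgorithm (𝕜 : Type*) [RCLike 𝕜] {F : Type*} [NormedAddCommGroup F]
    [NormedSpace 𝕜 F] {Y : Type*} (n : ℕ) (A : F → Y) : Prop :=
  ∃ (L : (v : Fin n) → (Fin v → 𝕜) → (F →L[𝕜] 𝕜)) (N : F → Fin n → 𝕜) (φ : (Fin n → 𝕜) → Y),
    (∀ f v, N f v = L v (fun i : Fin v => N f ⟨i, i.2.trans v.2⟩) f) ∧ ∀ f, A f = φ (N f)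

/-- `A` is an algorithm of the given class that uses `n` information operations. -/
def AlgorithmClass.Mem (𝒜 : AlgorithmClass) (𝕜 : Type*) [RCLike 𝕜] {F : Type*}
    [NormedAddCommGroup F] [NormedSpace 𝕜 F] {Y : Type*} [NormedAddCommGroup Y] [NormedSpace 𝕜 Y]
    (n : ℕ) (A : F → Y) : Prop :=
  match 𝒜 with
  | .linear => IsLinearAlgorithm 𝕜 n A
  | .adaptive => IsAdaptiveAlgorithm 𝕜 n A

/-- The worst case error of `A` on the unit ball, for the approximation of `T`. -/
def worstCaseError (T : F →L[𝕜] Y) (A : F → Y) : ℝ≥0∞ :=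
  ⨆ f ∈ Metric.closedBall (0 : F) 1, ‖A f - T f‖ₑ

/-- The `n`-th minimal error `e(n)`. -/
def minimalError (𝒜 : AlgorithmClass) (T : F →L[𝕜] Y) (n : ℕ) : ℝ≥0∞ :=
  ⨅ (A : F → Y) (_ : 𝒜.Mem 𝕜 n A), worstCaseError T A

/-- The information complexity `min {n | e(n) ≤ ε}`, with value `⊤` if there is no such `n`. -/
def informationComplexity (𝒜 : AlgorithmClass) (T : F →L[𝕜] Y) (ε : ℝ≥0∞) : ℕ∞ :=
  ⨅ (n : ℕ) (_ : minimalError 𝒜 T n ≤ ε), (n : ℕ∞)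

/-- Information complexity for the absolute error criterion. -/
def absoluteComplexity (𝒜 : AlgorithmClass) (T : F →L[𝕜] Y) (ε : ℝ) : ℕ∞ :=
  informationComplexity 𝒜 T (ENNReal.ofReal ε)

/-- Information complexity for the normalized error criterion: the initial error `e(0)` has to be
improved by the factor `ε`. -/
def normalizedComplexity (𝒜 : AlgorithmClass) (T : F →L[𝕜] Y) (ε : ℝ) : ℕ∞ :=
  informationComplexity 𝒜 T (ENNReal.ofReal ε * minimalError 𝒜 T 0)

end Complexity

/-- Strong polynomial tractability of a family of problems with information complexities `n(ε, d)`: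
`n(ε, d) ≤ C ε^{-p}` for all `ε ∈ (0, 1]` and all dimensions `d ≥ 1`. -/
def StronglyPolynomiallyTractable (n : ℝ → ℕ → ℕ∞) : Prop :=
  ∃ C p : ℝ, 0 < C ∧ 0 < p ∧ ∀ d : ℕ, 1 ≤ d → ∀ ε : ℝ, 0 < ε → ε ≤ 1 →
    (n ε d : ℝ≥0∞) ≤ ENNReal.ofReal (C * ε ^ (-p))

/-- `lam ∈ ℓ_τ` for some real `τ > 0`. -/
def InSomeLp (lam : ℕ → ℝ) : Prop :=
  ∃ τ : ℝ, 0 < τ ∧ Memℓp lam (ENNReal.ofReal τ)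

end SymTensor

end

/-! Tensor products of right singular vectors form a Hilbert basis of `H_d`, and `S_d` maps it to an
orthogonal family with squared norms `∏ λ_{k_l}`. On the (anti)symmetric subspace the coefficients
along a permutation orbit of index tuples agree up to sign, so one functional per orbit, that is per
multiset of indices, suffices; antisymmetry also kills all multisets with a repetition. Hence `n(ε,
d)` is at most the number of multisets whose product of squared singular values exceeds the squared
threshold (`minimalError_restrict_le`).

Upper bounds: the count is controlled by a generating function. With weights `x_j = (λ_j / a) ^ τ'`,
each multiset that counts contributes at least `ε ^ (2τ')` to a product of geometric series. In the
symmetric case the top index gets no series, since its multiplicity is determined by `d` and the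
others; this makes the bound independent of `d`. The remaining weights sum to at most `1/2` for
large `τ'`, because `λ₂ < a`. In the antisymmetric case the product is `∏ (1 + x_j) ≤ exp (∑ x_j)`,
with no condition on the size of the `λ_j`. The scale is `a = λ₁` for the normalized criterion in
part 1 and `a = 1` for the absolute criterion.

Lower bounds: a subspace of dimension greater than `n` on which `T` expands norms by at least `t`
forces `e(n) ≥ t`, even for adaptive nonlinear algorithms (`ofReal_le_minimalError`). For `d = 1`
this gives `e(n, 1) ≥ √(lam n)`, and polynomial decay of the errors gives `λ ∈ ℓ_τ`
(`inSomeLp_of_sqrt_le`). If `λ₁ = λ₂ = a`, the tensors `(b₀ + i b₁)^{⊗d}` span subspaces of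
dimension up to `d + 1` on which `S_d` is `√(a^d)` times an isometry, so about `d` functionals are
needed to reduce the error at all. -/

noncomputable section

namespace SymTensor

/-! ### Minimal errors: width bounds and linear algorithms. -/

section MinimalError

variable {𝕜 : Type*} [RCLike 𝕜] {F : Type*} [NormedAddCommGroup F] [NormedSpace 𝕜 F]
variable {Y : Type*} [NormedAddCommGroup Y] [NormedSpace 𝕜 Y]

theorem IsLinearAlgorithm.isAdaptiveAlgorithm {n : ℕ} {A : F → Y}
    (h : IsLinearAlgorithm 𝕜 n A) : IsAdaptiveAlgorithm 𝕜 n A := by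
  obtain ⟨L, g, h⟩ := h
  exact ⟨fun v _ => L v, fun f v => L v f, fun y => ∑ v, y v • g v, fun _ _ => rfl, h⟩

theorem AlgorithmClass.Mem.isAdaptiveAlgorithm {𝒜 : AlgorithmClass} {n : ℕ} {A : F → Y}
    (h : 𝒜.Mem 𝕜 n A) : IsAdaptiveAlgorithm 𝕜 n A := by
  cases 𝒜 with
  | linear => exact IsLinearAlgorithm.isAdaptiveAlgorithm h
  | adaptive => exact h

theorem IsLinearAlgorithm.mem {n : ℕ} {A : F → Y} (h : IsLinearAlgorithm 𝕜 n A)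
    (𝒜 : AlgorithmClass) : 𝒜.Mem 𝕜 n A := by
  cases 𝒜 with
  | linear => exact h
  | adaptive => exact h.isAdaptiveAlgorithm

/-- The `n`-th minimal error dominates the `n`-th Bernstein width. -/
theorem ofReal_le_minimalError (𝒜 : AlgorithmClass) (T : F →L[𝕜] Y) {n : ℕ} {t : ℝ}
    (V : Submodule 𝕜 F) (hV : n < Module.finrank 𝕜 V) (ht : ∀ v ∈ V, t * ‖v‖ ≤ ‖T v‖) :
    ENNReal.ofReal t ≤ minimalError 𝒜 T n := by
  refine le_iInf₂ fun A hA => ?_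
  obtain ⟨L, N, φ, hN, hφ⟩ := hA.isAdaptiveAlgorithm
  have : FiniteDimensional 𝕜 V := Module.finite_of_finrank_pos (by omega)
  -- Only the branch of the adaptive information on which all answers are zero matters. It consists
  -- of `n` fixed functionals, which have a common nonzero zero in `V`; all its multiples have
  -- information `0`.
  let R : V →ₗ[𝕜] (Fin n → 𝕜) :=
    LinearMap.pi fun v => (L v (fun _ => 0) : F →ₗ[𝕜] 𝕜) ∘ₗ V.subtype
  have hR : LinearMap.ker R ≠ ⊥ := LinearMap.ker_ne_bot_of_finrank_lt (by simpa using hV)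
  obtain ⟨v, hv, hv0⟩ := Submodule.exists_mem_ne_zero_of_ne_bot hR
  have hker : ∀ (c : 𝕜) (i : Fin n), L i (fun _ => 0) (c • (v : F)) = 0 := by
    intro c i
    have := congrFun (LinearMap.mem_ker.1 hv) i
    rw [map_smul, show L i (fun _ => 0) (v : F) = 0 from this, smul_zero]
  have hzero : ∀ (c : 𝕜), N (c • (v : F)) = 0 := by
    intro c
    funext i
    induction i using WellFoundedLT.induction with
    | ind i ih =>
      rw [hN]
      have : (fun j : Fin i => N (c • (v : F)) ⟨j, j.2.trans i.2⟩) = fun _ => 0 := by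
        funext j
        exact ih _ j.2
      rw [this, hker]
      rfl
  have hvpos : 0 < ‖(v : F)‖ := norm_pos_iff.2 (by simpa using hv0)
  set c : 𝕜 := ((‖(v : F)‖⁻¹ : ℝ) : 𝕜) with hc
  set w : F := c • (v : F) with hw
  have hnw : ‖w‖ = 1 := by
    rw [hw, norm_smul, hc, RCLike.norm_ofReal, abs_of_pos (inv_pos.2 hvpos),
      inv_mul_cancel₀ hvpos.ne']
  have hTw : t ≤ ‖T w‖ := by simpa [hnw] using ht w (V.smul_mem _ v.2)
  have h1 : A w = φ 0 := by rw [hφ, hzero]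
  have h2 : A (-w) = φ 0 := by rw [hφ, hw, ← neg_smul, hzero]
  -- `A` cannot tell `w` from `-w`, while `T w` and `T (-w)` are `2‖T w‖` apart.
  have h3 : t ≤ ‖A w - T w‖ ∨ t ≤ ‖A (-w) - T (-w)‖ := by
    by_contra! h
    have h4 : (2 : ℝ) * ‖T w‖ = ‖(A (-w) - T (-w)) - (A w - T w)‖ := by
      rw [h1, h2, map_neg, show φ 0 - -T w - (φ 0 - T w) = (2 : 𝕜) • T w by rw [two_smul]; abel,
        norm_smul, RCLike.norm_ofNat]
    have := norm_sub_le (A (-w) - T (-w)) (A w - T w)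
    linarith [h.1, h.2]
  rcases h3 with h3 | h3
  · refine le_trans ?_ (le_iSup₂ (f := fun f _ => ‖A f - T f‖ₑ) w (by simp [hnw]))
    rw [← ofReal_norm]
    exact ENNReal.ofReal_le_ofReal h3
  · refine le_trans ?_ (le_iSup₂ (f := fun f _ => ‖A f - T f‖ₑ) (-w) (by simp [hnw]))
    rw [← ofReal_norm]
    exact ENNReal.ofReal_le_ofReal h3

theorem minimalError_le_ofReal (𝒜 : AlgorithmClass) (T : F →L[𝕜] Y) {n : ℕ} {t : ℝ} {A : F → Y}
    (hA : IsLinearAlgorithm 𝕜 n A) (ht : 0 ≤ t) (h : ∀ f, ‖A f - T f‖ ≤ t * ‖f‖) :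
    minimalError 𝒜 T n ≤ ENNReal.ofReal t := by
  refine (iInf₂_le A (hA.mem 𝒜)).trans (iSup₂_le fun f hf => ?_)
  rw [← ofReal_norm]
  refine ENNReal.ofReal_le_ofReal ((h f).trans ?_)
  exact mul_le_of_le_one_right ht (by simpa using hf)

/-- A finite sum `∑ k, L_k(f) g_k` in which every functional is a multiple of the functional of
a chosen representative needs one evaluation for each class. -/
theorem isLinearAlgorithm_card_image {K Q : Type*} [DecidableEq Q] (s : Finset K) (q : K → Q)
    (L : K → (F →L[𝕜] 𝕜)) (g : K → Y)
    (h : ∀ k ∈ s, ∀ k' ∈ s, q k = q k' → ∃ c : 𝕜, L k = c • L k') :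
    IsLinearAlgorithm 𝕜 (s.image q).card (fun f => ∑ k ∈ s, L k f • g k) := by
  have hr : ∀ y : s.image q, ∃ k ∈ s, q k = y := fun y => Finset.mem_image.1 y.2
  choose r hrs hrq using hr
  have hc : ∀ k : s, ∃ c : 𝕜, L k = c • L (r ⟨q k, Finset.mem_image_of_mem q k.2⟩) :=
    fun k => h _ k.2 _ (hrs _) (hrq ⟨q k, Finset.mem_image_of_mem q k.2⟩).symm
  choose c hc using hc
  let e := (s.image q).equivFin
  refine ⟨fun v => L (r (e.symm v)),
    fun v => ∑ k : s, if q k = (e.symm v : Q) then c k • g k else 0, fun f => ?_⟩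
  rw [e.symm.sum_comp (fun y : s.image q => L (r y) f •
    ∑ k : s, if q k = (y : Q) then c k • g k else 0)]
  simp only [Finset.smul_sum]
  rw [Finset.sum_comm, ← Finset.sum_coe_sort s]
  refine Finset.sum_congr rfl fun k _ => ?_
  rw [Finset.sum_eq_single ⟨q k, Finset.mem_image_of_mem q k.2⟩]
  · rw [if_pos rfl, smul_smul, hc k, _root_.smul_apply, smul_eq_mul, mul_comm]
  · intro y _ hy
    rw [if_neg (fun h => hy (Subtype.ext h.symm)), smul_zero]
  · simp

theorem informationComplexity_le {𝒜 : AlgorithmClass} {T : F →L[𝕜] Y} {ε : ℝ≥0∞} {n : ℕ}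
    (h : minimalError 𝒜 T n ≤ ε) : informationComplexity 𝒜 T ε ≤ n :=
  iInf₂_le n h

theorem exists_minimalError_le {𝒜 : AlgorithmClass} {T : F →L[𝕜] Y} {ε : ℝ≥0∞} {C : ℝ}
    (h : (informationComplexity 𝒜 T ε : ℝ≥0∞) ≤ ENNReal.ofReal C) (hC : 0 ≤ C) :
    ∃ n : ℕ, (n : ℝ) ≤ C ∧ minimalError 𝒜 T n ≤ ε := by
  have hfin : informationComplexity 𝒜 T ε ≠ ⊤ := by
    intro h'
    rw [h'] at h
    simp at h
  have hex : ∃ n : ℕ, minimalError 𝒜 T n ≤ ε ∧ informationComplexity 𝒜 T ε = n := by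
    let s : Set ℕ := {n | minimalError 𝒜 T n ≤ ε}
    have hs : s.Nonempty := by
      by_contra hs
      refine hfin (iInf₂_eq_top.2 fun n hn => (hs ⟨n, hn⟩).elim)
    refine ⟨sInf s, Nat.sInf_mem hs, le_antisymm (informationComplexity_le (Nat.sInf_mem hs)) ?_⟩
    exact le_iInf₂ fun n hn => by exact_mod_cast Nat.sInf_le hn
  obtain ⟨n, hn, hn'⟩ := hex
  refine ⟨n, ?_, hn⟩
  rw [hn'] at h
  have h' : ((n : ℕ) : ℝ≥0∞) ≤ ENNReal.ofReal C := by simpa using h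
  rwa [← ENNReal.ofReal_natCast, ENNReal.ofReal_le_ofReal_iff hC] at h'

end MinimalError

/-! ### Tensor product bases and the action of permutations. -/

section TensorBasis

variable {𝕜 : Type*} [RCLike 𝕜] {H : Type*} [NormedAddCommGroup H] [InnerProductSpace 𝕜 H]
variable {G : Type*} [NormedAddCommGroup G] [InnerProductSpace 𝕜 G] {d : ℕ}

theorem norm_pureTensor (f : Fin d → H) : ‖pureTensor 𝕜 f‖ = ∏ l, ‖f l‖ := by
  have h : ‖pureTensor 𝕜 f‖ ^ 2 = (∏ l, ‖f l‖) ^ 2 := by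
    rw [← inner_self_eq_norm_sq (𝕜 := 𝕜), inner_pureTensor]
    simp only [inner_self_eq_norm_sq_to_K]
    rw [← Finset.prod_pow]
    norm_cast
  exact (pow_left_inj₀ (norm_nonneg _) (Finset.prod_nonneg fun _ _ => norm_nonneg _)
    two_ne_zero).1 h

/-- The simple tensor as a continuous linear function of one of its factors. -/
def pureTensorUpdate (f : Fin d → H) (i : Fin d) : H →L[𝕜] HilbertPower 𝕜 H d :=
  ((UniformSpace.Completion.toComplL (𝕜 := 𝕜) (E := AlgPower 𝕜 H d)).toLinearMap ∘ₗ
    (algPure 𝕜).toLinearMap f i).mkContinuous (∏ l ∈ Finset.univ.erase i, ‖f l‖) fun x => by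
    change ‖pureTensor 𝕜 (Function.update f i x)‖ ≤ _
    rw [norm_pureTensor, ← Finset.mul_prod_erase _ _ (Finset.mem_univ i), mul_comm,
      Function.update_self]
    refine le_of_eq (congrArg (· * ‖x‖) (Finset.prod_congr rfl fun l hl => ?_))
    rw [Function.update_of_ne (Finset.ne_of_mem_erase hl)]

theorem orthonormal_pureTensor {J : Type*} {b : J → H} (hb : Orthonormal 𝕜 b) :
    Orthonormal 𝕜 fun k : Fin d → J => pureTensor 𝕜 fun l => b (k l) := by
  refine ⟨fun k => by simp [norm_pureTensor, hb.1], fun k k' h => ?_⟩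
  obtain ⟨l, hl⟩ := Function.ne_iff.1 h
  change inner 𝕜 (pureTensor 𝕜 _) (pureTensor 𝕜 _) = 0
  rw [inner_pureTensor, Finset.prod_eq_zero (Finset.mem_univ l) (hb.2 hl)]

theorem eq_zero_of_inner_pureTensor_eq_zero {x : HilbertPower 𝕜 H d}
    (h : ∀ f : Fin d → H, inner 𝕜 (pureTensor 𝕜 f) x = 0) : x = 0 := by
  have h' : ∀ y : HilbertPower 𝕜 H d, inner 𝕜 y x = 0 := by
    intro y
    induction y using UniformSpace.Completion.induction_on with
    | hp => exact isClosed_eq (by fun_prop) continuous_const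
    | ih y =>
      induction y using alg_induction with
      | h₁ r f =>
        rw [UniformSpace.Completion.coe_smul, inner_smul_left]
        exact mul_eq_zero_of_right _ (h f)
      | h₂ y y' hy hy' => rw [UniformSpace.Completion.coe_add, inner_add_left, hy, hy', add_zero]
  exact inner_self_eq_zero.1 (h' x)

theorem inner_pureTensor_eq_zero_of_basis {J : Type*} (b : HilbertBasis J 𝕜 H)
    {x : HilbertPower 𝕜 H d}
    (h : ∀ k : Fin d → J, inner 𝕜 (pureTensor 𝕜 fun l => b (k l)) x = 0) (f : Fin d → H) :
    inner 𝕜 (pureTensor 𝕜 f) x = 0 := by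
  -- `s` is the set of slots that may hold arbitrary vectors. It grows one slot at a time, by
  -- linearity and continuity in that slot and density of the span of `b`.
  suffices hs : ∀ (s : Finset (Fin d)) (f : Fin d → H), (∀ l, l ∉ s → ∃ j, f l = b j) →
      inner 𝕜 (pureTensor 𝕜 f) x = 0 from hs Finset.univ f (by simp)
  intro s
  induction s using Finset.induction_on with
  | empty =>
    intro f hf
    choose k hk using fun l => hf l (by simp)
    rw [funext hk]
    exact h k
  | insert i s hi ih =>
    intro f hf
    let φ : H →L[𝕜] 𝕜 := innerSL 𝕜 x ∘L pureTensorUpdate f i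
    have hφ : φ = 0 := by
      refine ContinuousLinearMap.ext_on (s := Set.range b) ?_ ?_
      · rw [dense_iff_closure_eq]
        exact congrArg (fun V : Submodule 𝕜 H => (V : Set H)) b.dense_span
      · rintro _ ⟨j, rfl⟩
        change inner 𝕜 x (pureTensor 𝕜 (Function.update f i (b j))) = 0
        rw [inner_eq_zero_symm]
        refine ih _ fun l hl => ?_
        by_cases hli : l = i
        · exact ⟨j, by rw [hli, Function.update_self]⟩
        · rw [Function.update_of_ne hli]
          exact hf l (by simp [hli, hl])
    have h1 : φ (f i) = 0 := by rw [hφ]; rfl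
    change inner 𝕜 x (pureTensor 𝕜 (Function.update f i (f i))) = 0 at h1
    rwa [Function.update_eq_self, inner_eq_zero_symm] at h1

/-- The tensor power of a Hilbert basis. -/
def tensorBasis {J : Type*} (b : HilbertBasis J 𝕜 H) (d : ℕ) :
    HilbertBasis (Fin d → J) 𝕜 (HilbertPower 𝕜 H d) :=
  HilbertBasis.mkOfOrthogonalEqBot (orthonormal_pureTensor b.orthonormal) <| by
    rw [Submodule.eq_bot_iff]
    intro x hx
    refine eq_zero_of_inner_pureTensor_eq_zero (inner_pureTensor_eq_zero_of_basis b fun k => ?_)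
    exact (Submodule.mem_orthogonal _ _).1 hx _ (Submodule.subset_span ⟨k, rfl⟩)

theorem tensorBasis_apply {J : Type*} (b : HilbertBasis J 𝕜 H) (k : Fin d → J) :
    tensorBasis b d k = pureTensor 𝕜 fun l => b (k l) := by
  rw [tensorBasis, HilbertBasis.coe_mkOfOrthogonalEqBot]

theorem hasSum_norm_inner_sq {E J : Type*} [NormedAddCommGroup E] [InnerProductSpace 𝕜 E]
    (b : HilbertBasis J 𝕜 E) (x : E) : HasSum (fun j => ‖inner 𝕜 (b j) x‖ ^ 2) (‖x‖ ^ 2) := by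
  have h := b.hasSum_inner_mul_inner x x
  rw [inner_self_eq_norm_sq_to_K] at h
  have h' := RCLike.hasSum_re 𝕜 h
  convert h' using 1
  · funext j
    rw [← inner_conj_symm x (b j), RCLike.conj_mul]
    norm_cast
  · norm_cast

/-- Parseval's identity for an operator that maps a Hilbert basis to an orthogonal family. -/
theorem hasSum_norm_apply_sq {E Y J : Type*} [NormedAddCommGroup E] [InnerProductSpace 𝕜 E]
    [NormedAddCommGroup Y] [InnerProductSpace 𝕜 Y] (b : HilbertBasis J 𝕜 E) (T : E →L[𝕜] Y)
    (hT : ∀ i j, i ≠ j → inner 𝕜 (T (b i)) (T (b j)) = 0) (x : E) :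
    HasSum (fun j => ‖inner 𝕜 (b j) x‖ ^ 2 * ‖T (b j)‖ ^ 2) (‖T x‖ ^ 2) := by
  have hx : HasSum (fun j => inner 𝕜 (b j) x • T (b j)) (T x) := by
    have := T.hasSum (b.hasSum_repr x)
    simpa [b.repr_apply_apply, Function.comp_def] using this
  have h1 : ∀ j, inner 𝕜 (T (b j)) (T x) = inner 𝕜 (b j) x * ((‖T (b j)‖ ^ 2 : ℝ) : 𝕜) := by
    intro j
    have h2 := (innerSL 𝕜 (T (b j))).hasSum hx
    have h3 : HasSum (fun i => (innerSL 𝕜 (T (b j))) (inner 𝕜 (b i) x • T (b i)))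
        (inner 𝕜 (b j) x * ((‖T (b j)‖ ^ 2 : ℝ) : 𝕜)) := by
      convert hasSum_single j ?_ using 1
      · simp [inner_self_eq_norm_sq_to_K]
      · intro i hi
        simp [hT j i hi.symm]
    exact h2.unique h3
  have h4 := RCLike.hasSum_re 𝕜 ((innerSL 𝕜 (T x)).hasSum hx)
  convert h4 using 1
  · funext j
    simp only [map_smul, innerSL_apply_apply, smul_eq_mul]
    rw [← inner_conj_symm (T x), h1, map_mul (starRingEnd 𝕜), RCLike.conj_ofReal, ← mul_assoc,
      RCLike.mul_conj]
    norm_cast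
  · simp [inner_self_eq_norm_sq_to_K]

/-- Parseval on both sides reduces the estimate to single coefficients. In the application `x` is
the residual of a projection of `y`. -/
theorem norm_apply_le_of_coefficients {E Y J : Type*} [NormedAddCommGroup E]
    [InnerProductSpace 𝕜 E] [NormedAddCommGroup Y] [InnerProductSpace 𝕜 Y]
    (b : HilbertBasis J 𝕜 E) (T : E →L[𝕜] Y)
    (hT : ∀ i j, i ≠ j → inner 𝕜 (T (b i)) (T (b j)) = 0) {x y : E} {t : ℝ} (ht : 0 ≤ t)
    (h : ∀ j, ‖inner 𝕜 (b j) x‖ ^ 2 * ‖T (b j)‖ ^ 2 ≤ t ^ 2 * ‖inner 𝕜 (b j) y‖ ^ 2) :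
    ‖T x‖ ≤ t * ‖y‖ := by
  have := hasSum_le h (hasSum_norm_apply_sq b T hT x) ((hasSum_norm_inner_sq b y).mul_left _)
  rw [← mul_pow] at this
  exact le_of_sq_le_sq this (by positivity)

/-- The counterpart for lower bounds: only basis vectors that occur in `x` need a large image. -/
theorem le_norm_apply_of_coefficients {E Y J : Type*} [NormedAddCommGroup E]
    [InnerProductSpace 𝕜 E] [NormedAddCommGroup Y] [InnerProductSpace 𝕜 Y]
    (b : HilbertBasis J 𝕜 E) (T : E →L[𝕜] Y)
    (hT : ∀ i j, i ≠ j → inner 𝕜 (T (b i)) (T (b j)) = 0) {x : E} {t : ℝ}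
    (h : ∀ j, inner 𝕜 (b j) x ≠ 0 → t ^ 2 ≤ ‖T (b j)‖ ^ 2) :
    t * ‖x‖ ≤ ‖T x‖ := by
  have := hasSum_le (f := fun j => t ^ 2 * ‖inner 𝕜 (b j) x‖ ^ 2) (fun j => ?_)
    ((hasSum_norm_inner_sq b x).mul_left _) (hasSum_norm_apply_sq b T hT x)
  · rw [← mul_pow] at this
    exact le_of_sq_le_sq this (norm_nonneg _)
  · by_cases hj : inner 𝕜 (b j) x = 0
    · simp [hj]
    · rw [mul_comm]
      exact mul_le_mul_of_nonneg_left (h j hj) (by positivity)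

theorem powerOperator_tensorBasis [CompleteSpace G] {J : Type*} (b : HilbertBasis J 𝕜 H)
    (S : H →L[𝕜] G) (k : Fin d → J) :
    powerOperator S d (tensorBasis b d k) = pureTensor 𝕜 fun l => S (b (k l)) := by
  rw [tensorBasis_apply, powerOperator_pureTensor]

theorem norm_powerOperator_tensorBasis_sq [CompleteSpace G] {J : Type*} (b : HilbertBasis J 𝕜 H)
    (S : H →L[𝕜] G) (k : Fin d → J) :
    ‖powerOperator S d (tensorBasis b d k)‖ ^ 2 = ∏ l, ‖S (b (k l))‖ ^ 2 := by
  rw [powerOperator_tensorBasis, norm_pureTensor, Finset.prod_pow]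

theorem inner_powerOperator_tensorBasis [CompleteSpace G] {J : Type*} (b : HilbertBasis J 𝕜 H)
    (S : H →L[𝕜] G) (hS : ∀ i j, i ≠ j → inner 𝕜 (S (b i)) (S (b j)) = 0) (k k' : Fin d → J)
    (h : k ≠ k') :
    inner 𝕜 (powerOperator S d (tensorBasis b d k)) (powerOperator S d (tensorBasis b d k'))
      = 0 := by
  obtain ⟨l, hl⟩ := Function.ne_iff.1 h
  rw [powerOperator_tensorBasis, powerOperator_tensorBasis, inner_pureTensor,
    Finset.prod_eq_zero (Finset.mem_univ l) (hS _ _ hl)]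

theorem inner_permute (π : Equiv.Perm (Fin d)) (x y : HilbertPower 𝕜 H d) :
    inner 𝕜 (permute π x) (permute π y) = inner 𝕜 x y := by
  induction x, y using UniformSpace.Completion.induction_on₂ with
  | hp => exact isClosed_eq (by fun_prop) (by fun_prop)
  | ih x y =>
    rw [permute, extendCompl_coe, extendCompl_coe, UniformSpace.Completion.inner_coe,
      UniformSpace.Completion.inner_coe]
    exact inner_algPerm π x y

theorem permute_tensorBasis {J : Type*} (b : HilbertBasis J 𝕜 H) (π : Equiv.Perm (Fin d))
    (k : Fin d → J) : permute π (tensorBasis b d k) = tensorBasis b d (k ∘ π) := by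
  rw [tensorBasis_apply, tensorBasis_apply, permute_pureTensor]
  rfl

/-- `permute π` preserves inner products and permutes the tensor basis. The values `c = 1` and `c =
sgn π` cover both kinds of symmetry. -/
theorem inner_tensorBasis_comp_perm {J : Type*} (b : HilbertBasis J 𝕜 H)
    (π : Equiv.Perm (Fin d)) (k : Fin d → J) {f : HilbertPower 𝕜 H d} {c : 𝕜}
    (hf : f = c • permute π f) :
    inner 𝕜 (tensorBasis b d (k ∘ π)) f = c * inner 𝕜 (tensorBasis b d k) f := by
  conv_lhs => rw [hf]
  rw [inner_smul_right, ← permute_tensorBasis, inner_permute]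

/-- Swapping two slots with equal indices fixes the basis tensor but changes the sign of the
coefficient. -/
theorem inner_tensorBasis_eq_zero_of_not_injective {J : Type*} (b : HilbertBasis J 𝕜 H)
    {k : Fin d → J} (hk : ¬ Function.Injective k) {f : HilbertPower 𝕜 H d}
    (hf : f ∈ antisymmetricSubspace 𝕜 H d) : inner 𝕜 (tensorBasis b d k) f = 0 := by
  simp only [Function.Injective, not_forall] at hk
  obtain ⟨i, j, hij, hne⟩ := hk
  have h := inner_tensorBasis_comp_perm b (Equiv.swap i j) k (hf (Equiv.swap i j))
  have hc : k ∘ Equiv.swap i j = k := by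
    rw [Equiv.comp_swap_eq_update, hij, Function.update_eq_self, ← hij, Function.update_eq_self]
  rw [hc, Equiv.Perm.sign_swap hne] at h
  simpa [self_eq_neg] using h

end TensorBasis

/-! ### A Hilbert basis of right singular vectors. -/

section SingularBasis

variable {𝕜 : Type*} [RCLike 𝕜] {H : Type*} [NormedAddCommGroup H] [InnerProductSpace 𝕜 H]
  [CompleteSpace H] {G : Type*} [NormedAddCommGroup G] [InnerProductSpace 𝕜 G] [CompleteSpace G]

/-- A Hilbert basis of right singular vectors; `σ` lists those of the positive singular values. -/
theorem IsSquaredSingularValues.exists_hilbertBasis {S : H →L[𝕜] G} {lam : ℕ → ℝ}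
    (h : IsSquaredSingularValues S lam) :
    ∃ (u : Set H) (b : HilbertBasis u 𝕜 H) (σ : {m : ℕ // 0 < lam m} → u),
      Function.Injective σ ∧ (∀ m, ‖S (b (σ m))‖ ^ 2 = lam m) ∧
      (∀ j, j ∉ Set.range σ → S (b j) = 0) ∧
      ∀ i j, i ≠ j → inner 𝕜 (S (b i)) (S (b j)) = 0 := by
  obtain ⟨e, he, heig, hker⟩ := h.exists_eigenvectors
  obtain ⟨u, b, hu, hb⟩ := he.toSubtypeRange.exists_hilbertBasis_extension
  let σ : {m : ℕ // 0 < lam m} → u := fun m => ⟨e m, hu ⟨m, rfl⟩⟩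
  have hbσ : ∀ m, b (σ m) = e m := fun m => by rw [hb]
  have hzero : ∀ j, j ∉ Set.range σ → S (b j) = 0 := by
    intro j hj
    refine hker _ fun m => ?_
    rw [← hbσ]
    exact b.orthonormal.2 fun hm => hj ⟨m, hm⟩
  -- The eigenvector equation in weak form; it yields both the norms and the orthogonality of the
  -- images.
  have hinner : ∀ m x, inner 𝕜 (S (b (σ m))) (S x) = (lam m : 𝕜) * inner 𝕜 (b (σ m)) x := by
    intro m x
    rw [← ContinuousLinearMap.adjoint_inner_left, hbσ, heig, inner_smul_left, RCLike.conj_ofReal]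
  refine ⟨u, b, σ, fun m m' hm => he.linearIndependent.injective ?_, fun m => ?_, hzero, ?_⟩
  · exact congrArg Subtype.val hm
  · have := hinner m (b (σ m))
    rw [inner_self_eq_norm_sq_to_K, inner_self_eq_norm_sq_to_K, b.orthonormal.1] at this
    have h' : ((‖S (b (σ m))‖ ^ 2 : ℝ) : 𝕜) = ((lam m : ℝ) : 𝕜) := by simpa using this
    exact_mod_cast h'
  · intro i j hij
    by_cases hi : i ∈ Set.range σ
    · obtain ⟨m, rfl⟩ := hi
      rw [hinner, b.orthonormal.2 hij, mul_zero]
    · rw [hzero i hi, inner_zero_left]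

end SingularBasis

/-! ### Counting multisets with a large product of weights. -/

section Counting

variable {J : Type*}

/-- Expanding the product of truncated geometric series gives one nonnegative term per multiplicity
function on `T`. Members of `M` give distinct terms, each at least `δ`. As `T` only has to separate
`M`, it may leave out a letter. -/
theorem card_multisets_mul_le [DecidableEq J] (M : Finset (Multiset J)) (T : Finset J) (N : ℕ)
    {x : J → ℝ} (hx : ∀ j, 0 ≤ x j) {δ : ℝ}
    (hinj : ∀ m ∈ M, ∀ m' ∈ M, (∀ j ∈ T, m.count j = m'.count j) → m = m')
    (hN : ∀ m ∈ M, ∀ j, m.count j ≤ N)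
    (hδ : ∀ m ∈ M, δ ≤ ∏ j ∈ T, x j ^ m.count j) :
    M.card * δ ≤ ∏ j ∈ T, ∑ i ∈ Finset.range (N + 1), x j ^ i := by
  let Φ : Multiset J → T → ℕ := fun m j => m.count (j : J)
  have hΦ : Set.InjOn Φ M := fun m hm m' hm' h =>
    hinj m hm m' hm' fun j hj => congrFun h ⟨j, hj⟩
  calc M.card * δ = ∑ _m ∈ M, δ := by simp
    _ ≤ ∑ m ∈ M, ∏ j : T, x j ^ Φ m j := Finset.sum_le_sum fun m hm => by
        rw [Finset.prod_coe_sort T (fun j => x j ^ m.count j)]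
        exact hδ m hm
    _ = ∑ c ∈ M.image Φ, ∏ j : T, x j ^ c j := by rw [Finset.sum_image hΦ]
    _ ≤ ∑ c ∈ Fintype.piFinset fun _ : T => Finset.range (N + 1), ∏ j : T, x j ^ c j := by
        refine Finset.sum_le_sum_of_subset_of_nonneg ?_ fun c _ _ =>
          Finset.prod_nonneg fun j _ => pow_nonneg (hx j) _
        intro c hc
        obtain ⟨m, hm, rfl⟩ := Finset.mem_image.1 hc
        rw [Fintype.mem_piFinset]
        exact fun j => Finset.mem_range.2 (Nat.lt_succ_of_le (hN m hm j))
    _ = ∏ j ∈ T, ∑ i ∈ Finset.range (N + 1), x j ^ i := by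
        rw [← Finset.prod_univ_sum (fun _ : T => Finset.range (N + 1)) (fun j i => x j ^ i),
          Finset.prod_coe_sort T (fun j => ∑ i ∈ Finset.range (N + 1), x j ^ i)]

theorem sum_range_pow_le_exp {y : ℝ} (hy : 0 ≤ y) (hy' : y ≤ 1 / 2) (N : ℕ) :
    ∑ i ∈ Finset.range N, y ^ i ≤ Real.exp (2 * y) := by
  have h : ∑ i ∈ Finset.range N, y ^ i ≤ 2 * y + 1 := by
    induction N with
    | zero => simp; linarith
    | succ N ih =>
      rw [Finset.sum_range_succ']
      simp only [pow_succ, pow_zero]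
      rw [← Finset.sum_mul]
      nlinarith
  exact h.trans (Real.add_one_le_exp _)

/-- There are at most `e / δ` multisets of given size whose product of weights is at least `δ`,
if one weight is at most `1` and the others add up to at most `1 / 2`. -/
theorem card_multisets_mul_le_exp_one [DecidableEq J] (M : Finset (Multiset J)) (d : ℕ)
    {x : J → ℝ} (hx : ∀ j, 0 ≤ x j) {δ : ℝ} (j₀ : J) (hj₀ : x j₀ ≤ 1)
    (hsum : ∀ T : Finset J, j₀ ∉ T → ∑ j ∈ T, x j ≤ 1 / 2)
    (hM : ∀ m ∈ M, m.card = d) (hδ : ∀ m ∈ M, δ ≤ (m.map x).prod) :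
    M.card * δ ≤ Real.exp 1 := by
  -- The letter `j₀` is left out: its multiplicity is `d` minus the others, and its factor is at
  -- most `1`. Otherwise it would contribute a factor growing with `d` when `x j₀ = 1`.
  let T : Finset J := (M.biUnion Multiset.toFinset).erase j₀
  have hT : ∀ m ∈ M, ∀ j ∈ m, j ≠ j₀ → j ∈ T := fun m hm j hj hne =>
    Finset.mem_erase.2 ⟨hne, Finset.mem_biUnion.2 ⟨m, hm, Multiset.mem_toFinset.2 hj⟩⟩
  have hj₀T : j₀ ∉ T := Finset.notMem_erase _ _
  have hsub : ∀ m ∈ M, m.toFinset ⊆ insert j₀ T := by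
    intro m hm j hj
    by_cases h : j = j₀
    · exact Finset.mem_insert.2 (Or.inl h)
    · exact Finset.mem_insert.2 (Or.inr (hT m hm j (Multiset.mem_toFinset.1 hj) h))
  have hcard : ∀ m ∈ M, m.count j₀ + ∑ j ∈ T, m.count j = d := by
    intro m hm
    rw [← hM m hm, ← Multiset.sum_count_eq_card (s := insert j₀ T)
      (fun j hj => hsub m hm (Multiset.mem_toFinset.2 hj)), Finset.sum_insert hj₀T]
  have hhalf : ∀ j ∈ T, x j ≤ 1 / 2 := fun j hj => by
    simpa using hsum {j} (by simpa using fun h : j₀ = j => hj₀T (h ▸ hj))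
  refine (card_multisets_mul_le M T d hx ?_ ?_ ?_).trans ?_
  · intro m hm m' hm' h
    ext j
    by_cases hj : j ∈ T
    · exact h j hj
    · by_cases hj' : j = j₀
      · have h1 := hcard m hm
        have h2 := hcard m' hm'
        rw [Finset.sum_congr rfl h] at h1
        rw [hj']
        omega
      · rw [Multiset.count_eq_zero_of_notMem fun hm1 => hj (hT m hm j hm1 hj'),
          Multiset.count_eq_zero_of_notMem fun hm1 => hj (hT m' hm' j hm1 hj')]
  · intro m hm j
    exact (Multiset.count_le_card j m).trans (hM m hm).le
  · intro m hm
    refine (hδ m hm).trans ?_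
    rw [Finset.prod_multiset_map_count,
      Finset.prod_subset (hsub m hm) (fun j _ hj => by
        rw [Multiset.count_eq_zero_of_notMem (by simpa using hj), pow_zero]),
      Finset.prod_insert hj₀T]
    exact mul_le_of_le_one_left (Finset.prod_nonneg fun j _ => pow_nonneg (hx j) _)
      (pow_le_one₀ (hx j₀) hj₀)
  · calc ∏ j ∈ T, ∑ i ∈ Finset.range (d + 1), x j ^ i ≤ ∏ j ∈ T, Real.exp (2 * x j) :=
          Finset.prod_le_prod (fun j _ => Finset.sum_nonneg fun i _ => pow_nonneg (hx j) _)
            fun j hj => sum_range_pow_le_exp (hx j) (hhalf j hj) _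
      _ = Real.exp (2 * ∑ j ∈ T, x j) := by rw [← Real.exp_sum, Finset.mul_sum]
      _ ≤ Real.exp 1 := Real.exp_le_exp.2 (by linarith [hsum T hj₀T])

/-- Multiplicities are `0` or `1`, so each letter contributes only `1 + x j ≤ exp (x j)`; neither a
fixed size nor a distinguished letter is needed. -/
theorem card_nodup_multisets_mul_le_exp [DecidableEq J] (M : Finset (Multiset J))
    {x : J → ℝ} (hx : ∀ j, 0 ≤ x j) {δ s : ℝ} (hsum : ∀ T : Finset J, ∑ j ∈ T, x j ≤ s)
    (hM : ∀ m ∈ M, m.Nodup) (hδ : ∀ m ∈ M, δ ≤ (m.map x).prod) :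
    M.card * δ ≤ Real.exp s := by
  let T : Finset J := M.biUnion Multiset.toFinset
  have hT : ∀ m ∈ M, ∀ j ∈ m, j ∈ T := fun m hm j hj =>
    Finset.mem_biUnion.2 ⟨m, hm, Multiset.mem_toFinset.2 hj⟩
  refine (card_multisets_mul_le M T 1 hx ?_ ?_ ?_).trans ?_
  · intro m hm m' hm' h
    ext j
    by_cases hj : j ∈ T
    · exact h j hj
    · rw [Multiset.count_eq_zero_of_notMem fun hm1 => hj (hT m hm j hm1),
        Multiset.count_eq_zero_of_notMem fun hm1 => hj (hT m' hm' j hm1)]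
  · exact fun m hm => Multiset.nodup_iff_count_le_one.1 (hM m hm)
  · intro m hm
    refine (hδ m hm).trans (le_of_eq ?_)
    rw [Finset.prod_multiset_map_count]
    refine Finset.prod_subset (fun j hj => hT m hm j (Multiset.mem_toFinset.1 hj)) fun j _ hj => ?_
    rw [Multiset.count_eq_zero_of_notMem (by simpa using hj), pow_zero]
  · calc ∏ j ∈ T, ∑ i ∈ Finset.range (1 + 1), x j ^ i ≤ ∏ j ∈ T, Real.exp (x j) := by
          refine Finset.prod_le_prod (fun j _ => Finset.sum_nonneg fun i _ => pow_nonneg (hx j) _)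
            fun j hj => ?_
          have := Real.add_one_le_exp (x j)
          simpa [Finset.sum_range_succ, add_comm] using this
      _ = Real.exp (∑ j ∈ T, x j) := by rw [← Real.exp_sum]
      _ ≤ Real.exp s := Real.exp_le_exp.2 (hsum T)

/-- All but finitely many `Λ j` are below `η / M ^ d`, and one such factor outweighs the others. The
set `T` depends on `d` and `η`; it only serves to make the relevant index tuples finite in number.
-/
theorem exists_finset_prod_le (d : ℕ) {Λ : J → ℝ} (hΛ : ∀ j, 0 ≤ Λ j) {τ B : ℝ} (hτ : 0 < τ)
    (hs : Summable fun j => Λ j ^ τ) (hB : ∀ j, Λ j ≤ B) {η : ℝ} (hη : 0 < η) :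
    ∃ T : Finset J, ∀ k : Fin d → J, (∃ l, k l ∉ T) → ∏ l, Λ (k l) ≤ η := by
  set M := max 1 B with hM
  have hM1 : 1 ≤ M := le_max_left _ _
  set δ := η / M ^ d with hδ
  have hδpos : 0 < δ := by positivity
  have hfin := hs.tendsto_cofinite_zero.eventually_lt_const (Real.rpow_pos_of_pos hδpos τ)
  rw [Filter.eventually_cofinite] at hfin
  refine ⟨hfin.toFinset, fun k ⟨l, hl⟩ => ?_⟩
  have hl' : Λ (k l) ≤ δ := by
    have : Λ (k l) ^ τ < δ ^ τ := by simpa using hl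
    exact ((Real.rpow_lt_rpow_iff (hΛ _) hδpos.le hτ).1 this).le
  rw [← Finset.mul_prod_erase _ _ (Finset.mem_univ l)]
  calc Λ (k l) * ∏ i ∈ Finset.univ.erase l, Λ (k i)
      ≤ δ * ∏ _i ∈ Finset.univ.erase l, M := by
        refine mul_le_mul hl' ?_ (Finset.prod_nonneg fun _ _ => hΛ _) hδpos.le
        exact Finset.prod_le_prod (fun _ _ => hΛ _) fun i _ => (hB _).trans (le_max_right _ _)
    _ ≤ δ * M ^ d := by
        refine mul_le_mul_of_nonneg_left ?_ hδpos.le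
        rw [Finset.prod_const]
        exact pow_le_pow_right₀ hM1 (by simp)
    _ = η := by rw [hδ]; field_simp

/-- Raising the exponent makes the sum of a bounded family in `ℓ_τ` small. -/
theorem exists_exponent_sum_le {y : J → ℝ} (hy : ∀ j, 0 ≤ y j) {τ ρ : ℝ} (hτ : 0 < τ)
    (hs : Summable fun j => y j ^ τ) (j₀ : J) (hρ : ρ < 1) (hρ0 : 0 ≤ ρ)
    (hle : ∀ j, j ≠ j₀ → y j ≤ ρ) :
    ∃ τ' : ℝ, 0 < τ' ∧ ∀ T : Finset J, j₀ ∉ T → ∑ j ∈ T, y j ^ τ' ≤ 1 / 2 := by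
  set s := ∑' j, y j ^ τ with hsdef
  have hlim : Filter.Tendsto (fun n : ℕ => ρ ^ n * s) Filter.atTop (nhds 0) := by
    simpa using (tendsto_pow_atTop_nhds_zero_of_lt_one hρ0 hρ).mul_const s
  obtain ⟨n, hn⟩ := (hlim.eventually_lt_const (by norm_num : (0 : ℝ) < 1 / 2)).exists
  refine ⟨τ + n, by positivity, fun T hT => le_trans ?_ hn.le⟩
  calc ∑ j ∈ T, y j ^ (τ + n) ≤ ∑ j ∈ T, ρ ^ n * y j ^ τ := by
        refine Finset.sum_le_sum fun j hj => ?_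
        rw [Real.rpow_add_natCast' (hy j) (by positivity), mul_comm]
        exact mul_le_mul_of_nonneg_right
          (pow_le_pow_left₀ (hy j) (hle j fun h => hT (h ▸ hj)) n) (Real.rpow_nonneg (hy j) _)
    _ = ρ ^ n * ∑ j ∈ T, y j ^ τ := by rw [Finset.mul_sum]
    _ ≤ ρ ^ n * s := by
        refine mul_le_mul_of_nonneg_left ?_ (pow_nonneg hρ0 n)
        exact hs.sum_le_tsum T fun j _ => Real.rpow_nonneg (hy j) _

end Counting

/-! ### Upper bounds by projection onto finitely many orbits. -/

section UpperBound

variable {𝕜 : Type*} [RCLike 𝕜] {H : Type*} [NormedAddCommGroup H] [InnerProductSpace 𝕜 H]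
variable {G : Type*} [NormedAddCommGroup G] [InnerProductSpace 𝕜 G] [CompleteSpace G] {d : ℕ}
variable {J : Type*}

/-- The error of the projection onto finitely many tensor products of right singular vectors, on
a subspace on which the coefficients within each fibre of `q` are proportional. -/
theorem minimalError_restrict_le (𝒜 : AlgorithmClass) (b : HilbertBasis J 𝕜 H) (S : H →L[𝕜] G)
    (hS : ∀ i j, i ≠ j → inner 𝕜 (S (b i)) (S (b j)) = 0)
    (F : Submodule 𝕜 (HilbertPower 𝕜 H d)) (K : Finset (Fin d → J)) {t : ℝ} (ht : 0 ≤ t)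
    {Q : Type*} [DecidableEq Q] (q : (Fin d → J) → Q)
    (hq : ∀ k ∈ K, ∀ k' ∈ K, q k = q k' → ∃ c : 𝕜, ∀ f ∈ F,
      inner 𝕜 (tensorBasis b d k) f = c * inner 𝕜 (tensorBasis b d k') f)
    (hK : ∀ k, k ∉ K → ∏ l, ‖S (b (k l))‖ ^ 2 ≤ t ^ 2 ∨
      ∀ f ∈ F, inner 𝕜 (tensorBasis b d k) f = 0) :
    minimalError 𝒜 (powerOperator S d ∘L F.subtypeL) (K.image q).card ≤ ENNReal.ofReal t := by
  classical
  let L : (Fin d → J) → (F →L[𝕜] 𝕜) := fun k => innerSL 𝕜 (tensorBasis b d k) ∘L F.subtypeL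
  have hA := isLinearAlgorithm_card_image K q L (fun k => powerOperator S d (tensorBasis b d k))
    fun k hk k' hk' h => by
      obtain ⟨c, hc⟩ := hq k hk k' hk' h
      exact ⟨c, ContinuousLinearMap.ext fun f => hc f f.2⟩
  refine minimalError_le_ofReal 𝒜 _ hA ht fun f => ?_
  -- The residual of the projection in `H_d`; it need not lie in `F`. Its coefficients are `0` on
  -- `K` and those of `-f` elsewhere.
  let x : HilbertPower 𝕜 H d :=
    (∑ k ∈ K, inner 𝕜 (tensorBasis b d k) (f : HilbertPower 𝕜 H d) • tensorBasis b d k) - f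
  have hx : ∑ k ∈ K, L k f • powerOperator S d (tensorBasis b d k) -
      (powerOperator S d ∘L F.subtypeL) f = powerOperator S d x := by
    simp only [x, map_sub, map_sum, map_smul]
    rfl
  rw [hx]
  refine norm_apply_le_of_coefficients (tensorBasis b d) (powerOperator S d)
    (inner_powerOperator_tensorBasis b S hS) (y := (f : HilbertPower 𝕜 H d)) ht fun k => ?_
  rw [norm_powerOperator_tensorBasis_sq]
  by_cases hk : k ∈ K
  · have : inner 𝕜 (tensorBasis b d k) x = 0 := by
      simp only [x]
      rw [inner_sub_right, (tensorBasis b d).orthonormal.inner_right_sum _ hk, sub_self]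
    rw [this]
    simpa using by positivity
  · have : inner 𝕜 (tensorBasis b d k) x
        = - inner 𝕜 (tensorBasis b d k) (f : HilbertPower 𝕜 H d) := by
      simp only [x]
      rw [inner_sub_right, inner_sum, Finset.sum_eq_zero, zero_sub]
      intro k' hk'
      rw [inner_smul_right,
        (tensorBasis b d).orthonormal.2 (fun h : k = k' => hk (h ▸ hk')), mul_zero]
    rw [this, norm_neg]
    rcases hK k hk with h | h
    · rw [mul_comm]
      exact mul_le_mul_of_nonneg_right h (by positivity)
    · rw [h f f.2]
      simp

/-- Corresponding fibres of `k` and `k'` have equal cardinality, and bijections between them glue to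
`π`. Thus multisets label the orbits. -/
theorem exists_perm_of_map_eq {k k' : Fin d → J}
    (h : Finset.univ.val.map k = Finset.univ.val.map k') : ∃ π : Equiv.Perm (Fin d), k = k' ∘ π := by
  classical
  have hcard : ∀ j, Fintype.card {l // k l = j} = Fintype.card {l // k' l = j} := by
    intro j
    have := congrArg (Multiset.count j) h
    simp only [Multiset.count_map, eq_comm (a := j)] at this
    rw [Fintype.card_subtype, Fintype.card_subtype]
    exact this
  let e : ∀ j, {l // k l = j} ≃ {l // k' l = j} := fun j => Fintype.equivOfCardEq (hcard j)
  exact ⟨Equiv.ofFiberEquiv e, funext fun l => (Equiv.ofFiberEquiv_map e l).symm⟩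

/-- Dividing each factor by `a` absorbs the scale `a ^ d`, so the counting lemmas apply with `δ = ε
^ (2τ)`, independent of `d`. -/
theorem rpow_le_prod_rpow {d : ℕ} {Λ : J → ℝ} (hΛ : ∀ j, 0 ≤ Λ j) {a ε τ : ℝ} (ha : 0 < a)
    (hτ : 0 < τ) {k : Fin d → J} (hk : (ε * √(a ^ d)) ^ 2 < ∏ l, Λ (k l)) :
    (ε ^ 2) ^ τ ≤ ((Finset.univ.val.map k).map fun j => (Λ j / a) ^ τ).prod := by
  have h1 : ((Finset.univ.val.map k).map fun j => (Λ j / a) ^ τ).prod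
      = ∏ l, (Λ (k l) / a) ^ τ := by
    rw [Multiset.map_map]
    rfl
  rw [h1, Real.finsetProd_rpow _ _ fun l _ => div_nonneg (hΛ _) ha.le]
  refine Real.rpow_le_rpow (sq_nonneg _) ?_ hτ.le
  rw [Finset.prod_div_distrib, Finset.prod_const, Finset.card_univ, Fintype.card_fin,
    le_div_iff₀ (pow_pos ha d)]
  rw [mul_pow, Real.sq_sqrt (pow_nonneg ha.le d)] at hk
  exact hk.le

theorem le_mul_rpow_neg {N ε τ C : ℝ} (hε : 0 < ε) (h : N * (ε ^ 2) ^ τ ≤ C) :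
    N ≤ C * ε ^ (-(2 * τ)) := by
  rw [Real.rpow_neg hε.le, ← div_eq_mul_inv, le_div_iff₀ (Real.rpow_pos_of_pos hε _),
    Real.rpow_mul hε.le]
  exact_mod_cast h

/-- The exponent `τ` only makes `K` finite; `τ'` governs the count and hence the final power of `ε`.
-/
theorem exists_minimalError_symmetricProblem_le (𝒜 : AlgorithmClass) (b : HilbertBasis J 𝕜 H)
    (S : H →L[𝕜] G) (hS : ∀ i j, i ≠ j → inner 𝕜 (S (b i)) (S (b j)) = 0) {a τ : ℝ} (ha : 0 < a)
    (hτ : 0 < τ) (hs : Summable fun j => (‖S (b j)‖ ^ 2) ^ τ) (j₀ : J)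
    (hle : ∀ j, ‖S (b j)‖ ^ 2 ≤ a) {τ' : ℝ} (hτ' : 0 < τ')
    (hsum : ∀ T : Finset J, j₀ ∉ T → ∑ j ∈ T, (‖S (b j)‖ ^ 2 / a) ^ τ' ≤ 1 / 2)
    (d : ℕ) {ε : ℝ} (hε : 0 < ε) :
    ∃ n : ℕ, (n : ℝ) ≤ Real.exp 1 * ε ^ (-(2 * τ')) ∧
      minimalError 𝒜 (symmetricProblem S d) n ≤ ENNReal.ofReal (ε * √(a ^ d)) := by
  classical
  have ht : 0 < ε * √(a ^ d) := by positivity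
  obtain ⟨T, hT⟩ := exists_finset_prod_le d (fun j => sq_nonneg ‖S (b j)‖) hτ hs hle (pow_pos ht 2)
  let K := (Fintype.piFinset fun _ : Fin d => T).filter
    fun k => (ε * √(a ^ d)) ^ 2 < ∏ l, ‖S (b (k l))‖ ^ 2
  let q : (Fin d → J) → Multiset J := fun k => Finset.univ.val.map k
  refine ⟨(K.image q).card, le_mul_rpow_neg hε ?_,
    minimalError_restrict_le 𝒜 b S hS _ K ht.le q ?_ ?_⟩
  · refine card_multisets_mul_le_exp_one (K.image q) d
      (fun j => Real.rpow_nonneg (div_nonneg (sq_nonneg ‖S (b j)‖) ha.le) τ') j₀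
      (Real.rpow_le_one (by positivity) ((div_le_one ha).2 (hle j₀)) hτ'.le) hsum ?_ ?_
    · intro m hm
      obtain ⟨k, -, rfl⟩ := Finset.mem_image.1 hm
      simp [q]
    · intro m hm
      obtain ⟨k, hk, rfl⟩ := Finset.mem_image.1 hm
      exact rpow_le_prod_rpow (Λ := fun j => ‖S (b j)‖ ^ 2) (fun j => sq_nonneg _) ha hτ'
        (Finset.mem_filter.1 hk).2
  · intro k _ k' _ h
    obtain ⟨π, rfl⟩ := exists_perm_of_map_eq h
    exact ⟨1, fun f hf => inner_tensorBasis_comp_perm b π k' (by rw [one_smul]; exact hf π)⟩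
  · intro k hk
    left
    by_contra! h
    by_cases hkT : ∃ l, k l ∉ T
    · exact h.not_ge (hT k hkT)
    · push Not at hkT
      exact hk (Finset.mem_filter.2 ⟨Fintype.mem_piFinset.2 hkT, h⟩)

theorem exists_minimalError_antisymmetricProblem_le (𝒜 : AlgorithmClass) (b : HilbertBasis J 𝕜 H)
    (S : H →L[𝕜] G) (hS : ∀ i j, i ≠ j → inner 𝕜 (S (b i)) (S (b j)) = 0) {τ B : ℝ}
    (hτ : 0 < τ) (hs : Summable fun j => (‖S (b j)‖ ^ 2) ^ τ) (hB : ∀ j, ‖S (b j)‖ ^ 2 ≤ B)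
    (d : ℕ) {ε : ℝ} (hε : 0 < ε) :
    ∃ n : ℕ, (n : ℝ) ≤ Real.exp (∑' j, (‖S (b j)‖ ^ 2) ^ τ) * ε ^ (-(2 * τ)) ∧
      minimalError 𝒜 (antisymmetricProblem S d) n ≤ ENNReal.ofReal ε := by
  classical
  obtain ⟨T, hT⟩ := exists_finset_prod_le d (fun j => sq_nonneg ‖S (b j)‖) hτ hs hB (pow_pos hε 2)
  let K := (Fintype.piFinset fun _ : Fin d => T).filter
    fun k => ε ^ 2 < ∏ l, ‖S (b (k l))‖ ^ 2 ∧ Function.Injective k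
  let q : (Fin d → J) → Multiset J := fun k => Finset.univ.val.map k
  refine ⟨(K.image q).card, le_mul_rpow_neg hε ?_,
    minimalError_restrict_le 𝒜 b S hS _ K hε.le q ?_ ?_⟩
  · refine card_nodup_multisets_mul_le_exp (K.image q)
      (fun j => Real.rpow_nonneg (sq_nonneg ‖S (b j)‖) τ)
      (fun T => hs.sum_le_tsum T fun j _ => Real.rpow_nonneg (sq_nonneg _) _) ?_ ?_
    · intro m hm
      obtain ⟨k, hk, rfl⟩ := Finset.mem_image.1 hm
      exact Finset.univ.nodup.map (Finset.mem_filter.1 hk).2.2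
    · intro m hm
      obtain ⟨k, hk, rfl⟩ := Finset.mem_image.1 hm
      have := rpow_le_prod_rpow (Λ := fun j => ‖S (b j)‖ ^ 2) (a := 1) (ε := ε) (k := k)
        (fun j => sq_nonneg _) one_pos hτ (by simpa using (Finset.mem_filter.1 hk).2.1)
      simpa only [div_one] using this
  · intro k _ k' _ h
    obtain ⟨π, rfl⟩ := exists_perm_of_map_eq h
    exact ⟨_, fun f hf => inner_tensorBasis_comp_perm b π k' (hf π)⟩
  · intro k hk
    by_cases hinj : Function.Injective k
    · left
      by_contra! h
      by_cases hkT : ∃ l, k l ∉ T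
      · exact h.not_ge (hT k hkT)
      · push Not at hkT
        exact hk (Finset.mem_filter.2 ⟨Fintype.mem_piFinset.2 hkT, h, hinj⟩)
    · exact Or.inr fun f hf => inner_tensorBasis_eq_zero_of_not_injective b hinj hf

end UpperBound

/-! ### Lower bounds from subspaces with large images. -/

section LowerBound

variable {𝕜 : Type*} [RCLike 𝕜] {H : Type*} [NormedAddCommGroup H] [InnerProductSpace 𝕜 H]
variable {G : Type*} [NormedAddCommGroup G] [InnerProductSpace 𝕜 G] [CompleteSpace G] {d : ℕ}
variable {J : Type*}

theorem ofReal_le_minimalError_restrict (𝒜 : AlgorithmClass) (b : HilbertBasis J 𝕜 H)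
    (S : H →L[𝕜] G) (hS : ∀ i j, i ≠ j → inner 𝕜 (S (b i)) (S (b j)) = 0)
    (F : Submodule 𝕜 (HilbertPower 𝕜 H d)) {n : ℕ} (ψ : Fin (n + 1) → HilbertPower 𝕜 H d)
    (hψ : ∀ i, ψ i ∈ F) (hlin : LinearIndependent 𝕜 ψ) {t : ℝ}
    (ht : ∀ k i, inner 𝕜 (tensorBasis b d k) (ψ i) ≠ 0 → t ^ 2 ≤ ∏ l, ‖S (b (k l))‖ ^ 2) :
    ENNReal.ofReal t ≤ minimalError 𝒜 (powerOperator S d ∘L F.subtypeL) n := by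
  let ψ' : Fin (n + 1) → F := fun i => ⟨ψ i, hψ i⟩
  have hψ' : LinearIndependent 𝕜 ψ' := LinearIndependent.of_comp F.subtype hlin
  refine ofReal_le_minimalError 𝒜 _ (Submodule.span 𝕜 (Set.range ψ')) ?_ fun v hv => ?_
  · rw [finrank_span_eq_card hψ', Fintype.card_fin]
    exact Nat.lt_succ_self n
  · refine le_norm_apply_of_coefficients (tensorBasis b d) (powerOperator S d)
      (inner_powerOperator_tensorBasis b S hS) (x := (v : HilbertPower 𝕜 H d)) fun k hk => ?_
    rw [norm_powerOperator_tensorBasis_sq]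
    by_contra hlt
    refine hk ?_
    -- A coefficient functional at an index with too small a singular value kills every `ψ i`, hence
    -- their span.
    have hle : Submodule.span 𝕜 (Set.range ψ') ≤
        LinearMap.ker ((innerSL 𝕜 (tensorBasis b d k) ∘L F.subtypeL : F →L[𝕜] 𝕜) : F →ₗ[𝕜] 𝕜) := by
      rw [Submodule.span_le]
      rintro _ ⟨i, rfl⟩
      by_contra hi
      exact hlt (ht k i hi)
    exact hle hv

theorem ofReal_sqrt_le_minimalError_one (𝒜 : AlgorithmClass) (b : HilbertBasis J 𝕜 H)
    (S : H →L[𝕜] G) (hS : ∀ i j, i ≠ j → inner 𝕜 (S (b i)) (S (b j)) = 0)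
    (F : Submodule 𝕜 (HilbertPower 𝕜 H 1)) (hF : ∀ k, tensorBasis b 1 k ∈ F) {lam : ℕ → ℝ}
    (hlam : Antitone lam) {σ : {m : ℕ // 0 < lam m} → J} (hσ : Function.Injective σ)
    (hσlam : ∀ m, ‖S (b (σ m))‖ ^ 2 = lam m) (n : ℕ) :
    ENNReal.ofReal √(lam n) ≤ minimalError 𝒜 (powerOperator S 1 ∘L F.subtypeL) n := by
  by_cases hn : 0 < lam n
  · have hpos : ∀ i : Fin (n + 1), 0 < lam i := fun i => hn.trans_le (hlam (Fin.is_le i))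
    -- The `n + 1` singular vectors with indices `0, …, n`; the smallest squared singular value
    -- among them is `lam n`.
    let κ : Fin (n + 1) → Fin 1 → J := fun i _ => σ ⟨i, hpos i⟩
    have hκ : Function.Injective κ := fun i j hij => by
      have := hσ (congrFun hij 0)
      exact Fin.ext (congrArg Subtype.val this)
    refine ofReal_le_minimalError_restrict 𝒜 b S hS F (fun i => tensorBasis b 1 (κ i))
      (fun i => hF _) ((tensorBasis b 1).orthonormal.linearIndependent.comp κ hκ) fun k i hk => ?_
    have hki : k = κ i := by
      by_contra h
      exact hk ((tensorBasis b 1).orthonormal.2 h)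
    rw [hki, Real.sq_sqrt hn.le, Fin.prod_univ_one, hσlam]
    exact hlam (Fin.is_le i)
  · rw [Real.sqrt_eq_zero_of_nonpos (not_lt.1 hn), ENNReal.ofReal_zero]
    exact zero_le

theorem pureTensor_const_mem_symmetricSubspace (x : H) :
    pureTensor 𝕜 (fun _ : Fin d => x) ∈ symmetricSubspace 𝕜 H d := fun π => by
  rw [permute_pureTensor]

theorem inner_tensorBasis_pureTensor_add (b : HilbertBasis J 𝕜 H) {j₀ j₁ : J} (hne : j₀ ≠ j₁)
    (c : 𝕜) (k : Fin d → J) [DecidableEq J] :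
    inner 𝕜 (tensorBasis b d k) (pureTensor 𝕜 fun _ : Fin d => b j₀ + c • b j₁)
      = ∏ l, if k l = j₁ then c else if k l = j₀ then 1 else 0 := by
  rw [tensorBasis_apply, inner_pureTensor]
  refine Finset.prod_congr rfl fun l _ => ?_
  rw [inner_add_right, inner_smul_right, orthonormal_iff_ite.1 b.orthonormal,
    orthonormal_iff_ite.1 b.orthonormal]
  by_cases h1 : k l = j₁
  · simp [h1, hne.symm]
  · simp [h1]

/-- Pairing a vanishing combination with a basis tensor that has `r` entries `j₁` and `d - r`
entries `j₀` gives `∑ c_i i ^ r = 0`. This works for all `r ≤ n ≤ d`, and the Vandermonde matrix of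
the nodes `0, …, n` is invertible. -/
theorem linearIndependent_pureTensor_add (b : HilbertBasis J 𝕜 H) {j₀ j₁ : J} (hne : j₀ ≠ j₁)
    {n : ℕ} (hn : n ≤ d) :
    LinearIndependent 𝕜 fun i : Fin (n + 1) =>
      pureTensor 𝕜 fun _ : Fin d => b j₀ + ((i : ℕ) : 𝕜) • b j₁ := by
  classical
  rw [Fintype.linearIndependent_iff]
  intro c hc
  have hinj : Function.Injective fun i : Fin (n + 1) => ((i : ℕ) : 𝕜) := fun i j h =>
    Fin.ext (Nat.cast_injective h)
  refine congrFun (Matrix.eq_zero_of_forall_pow_sum_mul_pow_eq_zero hinj fun r => ?_)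
  let k : Fin d → J := fun l => if (l : ℕ) < r then j₁ else j₀
  have h := congrArg (inner 𝕜 (tensorBasis b d k)) hc
  rw [inner_sum, inner_zero_right] at h
  rw [← h]
  refine Finset.sum_congr rfl fun i _ => ?_
  rw [inner_smul_right, inner_tensorBasis_pureTensor_add b hne]
  congr 1
  have : ∀ l : Fin d, (if k l = j₁ then ((i : ℕ) : 𝕜) else if k l = j₀ then 1 else 0)
      = if (l : ℕ) < r then ((i : ℕ) : 𝕜) else 1 := by
    intro l
    by_cases hl : (l : ℕ) < r
    · simp [k, hl]
    · simp [k, hl, hne]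
  simp only [this]
  rw [Finset.prod_ite, Finset.prod_const, Finset.prod_const_one, mul_one, Fin.card_filter_val_lt,
    min_eq_right (by have := r.2; omega)]

/-- Powers of vectors in the span of `b j₀` and `b j₁` are symmetric, and they involve only basis
tensors whose squared singular value is exactly `a ^ d`. -/
theorem ofReal_sqrt_pow_le_minimalError_symmetricProblem (𝒜 : AlgorithmClass)
    (b : HilbertBasis J 𝕜 H) (S : H →L[𝕜] G)
    (hS : ∀ i j, i ≠ j → inner 𝕜 (S (b i)) (S (b j)) = 0) {j₀ j₁ : J} (hne : j₀ ≠ j₁) {a : ℝ}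
    (h₀ : ‖S (b j₀)‖ ^ 2 = a) (h₁ : ‖S (b j₁)‖ ^ 2 = a) {n : ℕ} (hn : n ≤ d) :
    ENNReal.ofReal √(a ^ d) ≤ minimalError 𝒜 (symmetricProblem S d) n := by
  classical
  have ha : 0 ≤ a := h₀ ▸ sq_nonneg _
  refine ofReal_le_minimalError_restrict 𝒜 b S hS _ _
    (fun i => pureTensor_const_mem_symmetricSubspace _)
    (linearIndependent_pureTensor_add b hne hn) fun k i hk => ?_
  rw [inner_tensorBasis_pureTensor_add b hne, Finset.prod_ne_zero_iff] at hk
  have hkl : ∀ l, ‖S (b (k l))‖ ^ 2 = a := by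
    intro l
    by_cases h : k l = j₁
    · rw [h, h₁]
    · by_cases h' : k l = j₀
      · rw [h', h₀]
      · exact (hk l (Finset.mem_univ l) (by simp [h, h'])).elim
  simp [hkl, Real.sq_sqrt (pow_nonneg ha d)]

/-- For a top index `j₀`, this and `minimalError_symmetricProblem_zero_le` identify the initial
error as `√(λ₁ ^ d)`. -/
theorem ofReal_sqrt_pow_le_minimalError_zero (𝒜 : AlgorithmClass)
    (b : HilbertBasis J 𝕜 H) (S : H →L[𝕜] G)
    (hS : ∀ i j, i ≠ j → inner 𝕜 (S (b i)) (S (b j)) = 0) (j₀ : J) (d : ℕ) :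
    ENNReal.ofReal √((‖S (b j₀)‖ ^ 2) ^ d) ≤ minimalError 𝒜 (symmetricProblem S d) 0 := by
  refine ofReal_le_minimalError_restrict 𝒜 b S hS _ (fun _ : Fin (0 + 1) =>
    tensorBasis b d fun _ => j₀) (fun i => ?_)
    ((tensorBasis b d).orthonormal.linearIndependent.comp _
      fun i j _ => Subsingleton.elim (α := Fin 1) i j)
    fun k i hk => ?_
  · rw [tensorBasis_apply]
    exact pureTensor_const_mem_symmetricSubspace _
  · have hki : k = fun _ => j₀ := by
      by_contra h
      exact hk ((tensorBasis b d).orthonormal.2 h)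
    rw [hki, Real.sq_sqrt (by positivity)]
    simp

theorem minimalError_symmetricProblem_zero_le (𝒜 : AlgorithmClass) (b : HilbertBasis J 𝕜 H)
    (S : H →L[𝕜] G) (hS : ∀ i j, i ≠ j → inner 𝕜 (S (b i)) (S (b j)) = 0) {a : ℝ} (ha : 0 ≤ a)
    (hle : ∀ j, ‖S (b j)‖ ^ 2 ≤ a) (d : ℕ) :
    minimalError 𝒜 (symmetricProblem S d) 0 ≤ ENNReal.ofReal √(a ^ d) := by
  have := minimalError_restrict_le 𝒜 b S hS (symmetricSubspace 𝕜 H d) ∅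
    (Real.sqrt_nonneg (a ^ d)) (fun _ => ()) (by simp) fun k _ => Or.inl <| by
      rw [Real.sq_sqrt (pow_nonneg ha d)]
      calc ∏ l, ‖S (b (k l))‖ ^ 2 ≤ ∏ _l : Fin d, a :=
            Finset.prod_le_prod (fun _ _ => sq_nonneg _) fun l _ => hle _
        _ = a ^ d := by simp
  simpa [symmetricProblem] using this

end LowerBound

/-! ### Summability of the singular values. -/

/-- Solving `C ε ^ (-p) = N` gives `ε = (C / N) ^ (1 / p)`, hence `lam N ≤ κ² ε²` and `lam N ^ p =
O(N ^ (-2))`. The exponent `p` is safe, whereas `p / 2` would only give the harmonic series. The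
factor `κ` accommodates the initial error. -/
theorem inSomeLp_of_sqrt_le {lam : ℕ → ℝ} (hlam : Antitone lam) (hnn : ∀ m, 0 ≤ lam m)
    {C p κ : ℝ} (hC : 0 < C) (hp : 0 < p)
    (h : ∀ ε : ℝ, 0 < ε → ε ≤ 1 → ∃ n : ℕ, (n : ℝ) ≤ C * ε ^ (-p) ∧ √(lam n) ≤ κ * ε) :
    InSomeLp lam := by
  refine ⟨p, hp, ?_⟩
  rw [memℓp_gen_iff (by rwa [ENNReal.toReal_ofReal hp.le]), ENNReal.toReal_ofReal hp.le]
  have hsum : Summable fun N : ℕ => (κ ^ 2) ^ p * C ^ 2 * (1 / (N : ℝ) ^ 2) :=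
    (Real.summable_one_div_nat_pow.2 one_lt_two).mul_left _
  refine hsum.of_norm_bounded_eventually_nat ?_
  -- `N ≥ C` ensures that the chosen `ε` is at most `1`.
  filter_upwards [Filter.eventually_ge_atTop (max 1 ⌈C⌉₊)] with N hN
  have hN1 : (0 : ℝ) < N := by exact_mod_cast (le_max_left _ _).trans hN
  have hNC : C ≤ N := (Nat.le_ceil C).trans (by exact_mod_cast (le_max_right _ _).trans hN)
  have hq : 0 < C / N := div_pos hC hN1
  have hε : 0 < (C / N) ^ (1 / p) := Real.rpow_pos_of_pos hq _
  obtain ⟨n, hn, hn'⟩ := h _ hε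
    (Real.rpow_le_one hq.le ((div_le_one hN1).2 hNC) (by positivity))
  have hεp : ((C / N) ^ (1 / p)) ^ p = C / N := by
    rw [← Real.rpow_mul hq.le, one_div_mul_cancel hp.ne', Real.rpow_one]
  have hnN : n ≤ N := by
    rw [Real.rpow_neg hε.le, hεp, inv_div, mul_div_cancel₀ _ hC.ne'] at hn
    exact_mod_cast hn
  have hle : lam N ≤ κ ^ 2 * ((C / N) ^ (1 / p)) ^ 2 := by
    refine (hlam hnN).trans ?_
    rw [← mul_pow, ← Real.sq_sqrt (hnn n)]
    exact pow_le_pow_left₀ (Real.sqrt_nonneg _) hn' 2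
  rw [Real.norm_of_nonneg (by positivity), Real.norm_of_nonneg (hnn N)]
  calc lam N ^ p ≤ (κ ^ 2 * ((C / N) ^ (1 / p)) ^ 2) ^ p := Real.rpow_le_rpow (hnn N) hle hp.le
    _ = (κ ^ 2) ^ p * (((C / N) ^ (1 / p)) ^ p) ^ 2 := by
        rw [Real.mul_rpow (by positivity) (by positivity), ← Real.rpow_pow_comm hε.le]
    _ = (κ ^ 2) ^ p * C ^ 2 * (1 / (N : ℝ) ^ 2) := by rw [hεp, div_pow]; ring

/-- A common description of the singular value data: a Hilbert basis of right singular vectors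
with two distinguished members that belong to the two largest singular values. -/
theorem IsSquaredSingularValues.exists_basis_bounds {𝕜 : Type*} [RCLike 𝕜]
    {H : Type*} [NormedAddCommGroup H] [InnerProductSpace 𝕜 H] [CompleteSpace H]
    {G : Type*} [NormedAddCommGroup G] [InnerProductSpace 𝕜 G] [CompleteSpace G]
    {S : H →L[𝕜] G} {lam : ℕ → ℝ} (h : IsSquaredSingularValues S lam) (h₁ : 0 < lam 1) :
    ∃ (u : Set H) (b : HilbertBasis u 𝕜 H) (σ : {m : ℕ // 0 < lam m} → u) (j₀ j₁ : u),
      Function.Injective σ ∧ (∀ m, ‖S (b (σ m))‖ ^ 2 = lam m) ∧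
      (∀ i j, i ≠ j → inner 𝕜 (S (b i)) (S (b j)) = 0) ∧ j₀ ≠ j₁ ∧
      ‖S (b j₀)‖ ^ 2 = lam 0 ∧ ‖S (b j₁)‖ ^ 2 = lam 1 ∧ (∀ j, ‖S (b j)‖ ^ 2 ≤ lam 0) ∧
      (∀ j, j ≠ j₀ → ‖S (b j)‖ ^ 2 ≤ lam 1) ∧
      ∀ τ : ℝ, 0 < τ → (Summable fun m => ‖lam m‖ ^ τ) →
        Summable fun j => (‖S (b j)‖ ^ 2) ^ τ := by
  obtain ⟨u, b, σ, hσ, hlam, hzero, hS⟩ := h.exists_hilbertBasis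
  have h₀ : 0 < lam 0 := h₁.trans_le (h.antitone zero_le_one)
  refine ⟨u, b, σ, σ ⟨0, h₀⟩, σ ⟨1, h₁⟩, hσ, hlam, hS, fun h => ?_, hlam _, hlam _, ?_, ?_, ?_⟩
  · simpa using hσ h
  · intro j
    by_cases hj : j ∈ Set.range σ
    · obtain ⟨m, rfl⟩ := hj
      rw [hlam]
      exact h.antitone (Nat.zero_le _)
    · rw [hzero j hj]
      simpa using h₀.le
  · intro j hne
    by_cases hj : j ∈ Set.range σ
    · obtain ⟨m, rfl⟩ := hj
      rw [hlam]
      refine h.antitone (Nat.one_le_iff_ne_zero.2 fun hm => hne ?_)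
      exact congrArg σ (Subtype.ext hm)
    · rw [hzero j hj]
      simpa using h₁.le
  · intro τ hτ hs
    -- Basis vectors outside the range of `σ` contribute `0 ^ τ = 0`, so the sum runs over the
    -- positive `lam m` only.
    rw [← hσ.summable_iff fun j hj => by rw [hzero j hj]; simp [Real.zero_rpow hτ.ne']]
    refine (hs.subtype {m | 0 < lam m}).congr fun m => ?_
    simp only [Function.comp]
    rw [hlam, Real.norm_of_nonneg (h.nonneg _)]

/-! ### From minimal errors to tractability and back. -/

section Tractability

theorem InSomeLp.exists_summable {lam : ℕ → ℝ} (h : InSomeLp lam) :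
    ∃ τ : ℝ, 0 < τ ∧ Summable fun m => ‖lam m‖ ^ τ := by
  obtain ⟨τ, hτ, h⟩ := h
  rw [memℓp_gen_iff (by rwa [ENNReal.toReal_ofReal hτ.le]), ENNReal.toReal_ofReal hτ.le] at h
  exact ⟨τ, hτ, h⟩

variable {𝕜 : Type*} [RCLike 𝕜] {F : ℕ → Type*} [∀ d, NormedAddCommGroup (F d)]
  [∀ d, NormedSpace 𝕜 (F d)] {Y : ℕ → Type*} [∀ d, NormedAddCommGroup (Y d)]
  [∀ d, NormedSpace 𝕜 (Y d)]

/-- The threshold `δ ε d` is `ε` or `ε` times the initial error, so that one statement serves both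
criteria. -/
theorem stronglyPolynomiallyTractable_of_minimalError_le {𝒜 : AlgorithmClass}
    {T : ∀ d, F d →L[𝕜] Y d} {δ : ℝ → ℕ → ℝ≥0∞} {C p : ℝ} (hC : 0 < C) (hp : 0 < p)
    (h : ∀ d (ε : ℝ), 0 < ε →
      ∃ n : ℕ, (n : ℝ) ≤ C * ε ^ (-p) ∧ minimalError 𝒜 (T d) n ≤ δ ε d) :
    StronglyPolynomiallyTractable fun ε d => informationComplexity 𝒜 (T d) (δ ε d) := by
  refine ⟨C, p, hC, hp, fun d _ ε hε _ => ?_⟩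
  obtain ⟨n, hn, hn'⟩ := h d ε hε
  calc ((informationComplexity 𝒜 (T d) (δ ε d) : ℕ∞) : ℝ≥0∞) ≤ ((n : ℕ∞) : ℝ≥0∞) :=
        ENat.toENNReal_le.2 (informationComplexity_le hn')
    _ = ENNReal.ofReal n := by simp
    _ ≤ ENNReal.ofReal (C * ε ^ (-p)) := ENNReal.ofReal_le_ofReal hn

theorem StronglyPolynomiallyTractable.exists_minimalError_le {𝒜 : AlgorithmClass}
    {T : ∀ d, F d →L[𝕜] Y d} {δ : ℝ → ℕ → ℝ≥0∞}
    (h : StronglyPolynomiallyTractable fun ε d => informationComplexity 𝒜 (T d) (δ ε d)) :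
    ∃ C p : ℝ, 0 < C ∧ 0 < p ∧ ∀ d : ℕ, 1 ≤ d → ∀ ε : ℝ, 0 < ε → ε ≤ 1 →
      ∃ n : ℕ, (n : ℝ) ≤ C * ε ^ (-p) ∧ minimalError 𝒜 (T d) n ≤ δ ε d := by
  obtain ⟨C, p, hC, hp, h⟩ := h
  exact ⟨C, p, hC, hp, fun d hd ε hε hε1 => SymTensor.exists_minimalError_le (h d hd ε hε hε1)
    (mul_nonneg hC.le (Real.rpow_nonneg hε.le _))⟩

/-- Strong polynomial tractability fails if the initial `d` minimal errors in dimension `d` exceed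
half of the scale `r d`. -/
theorem not_stronglyPolynomiallyTractable {𝒜 : AlgorithmClass}
    {T : ∀ d, F d →L[𝕜] Y d} {δ : ℝ → ℕ → ℝ≥0∞} {r : ℕ → ℝ} (hr : ∀ d, 0 < r d)
    (hδ : ∀ d, δ (1 / 2) d ≤ ENNReal.ofReal (1 / 2 * r d))
    (h : ∀ d n : ℕ, n ≤ d → ENNReal.ofReal (r d) ≤ minimalError 𝒜 (T d) n) :
    ¬ StronglyPolynomiallyTractable fun ε d => informationComplexity 𝒜 (T d) (δ ε d) := by
  intro hT
  obtain ⟨C, p, hC, hp, hT⟩ := hT.exists_minimalError_le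
  -- The bound at `ε = 1/2` does not depend on `d`, so a dimension at least as large as that bound
  -- gives `n ≤ d`.
  set d := max 1 ⌈C * (1 / 2 : ℝ) ^ (-p)⌉₊ with hd
  obtain ⟨n, hn, hn'⟩ := hT d (le_max_left _ _) (1 / 2) (by norm_num) (by norm_num)
  have hnd : n ≤ d := by
    have : (n : ℝ) ≤ d := hn.trans ((Nat.le_ceil _).trans (by exact_mod_cast le_max_right _ _))
    exact_mod_cast this
  have := ((h d n hnd).trans hn').trans (hδ d)
  rw [ENNReal.ofReal_le_ofReal_iff (by linarith [hr d])] at this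
  linarith [hr d]

end Tractability

end SymTensor

end

/-! ### The characterizations of strong polynomial tractability. -/

theorem mainTheorem5 {𝕜 : Type*} [RCLike 𝕜]
    {H : Type*} [NormedAddCommGroup H] [InnerProductSpace 𝕜 H] [CompleteSpace H]
    {G : Type*} [NormedAddCommGroup G] [InnerProductSpace 𝕜 G] [CompleteSpace G]
    (S : H →L[𝕜] G) (hS : IsCompactOperator S)
    (lam : ℕ → ℝ) (hlam : SymTensor.IsSquaredSingularValues S lam) (hlam₂ : 0 < lam 1)
    (𝒜 : SymTensor.AlgorithmClass) :
    (SymTensor.StronglyPolynomiallyTractable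
        (fun ε d => SymTensor.normalizedComplexity 𝒜 (SymTensor.symmetricProblem S d) ε) ↔
      SymTensor.InSomeLp lam ∧ lam 1 < lam 0) ∧
    (lam 0 ≤ 1 →
      (SymTensor.StronglyPolynomiallyTractable
          (fun ε d => SymTensor.absoluteComplexity 𝒜 (SymTensor.symmetricProblem S d) ε) ↔
        SymTensor.InSomeLp lam ∧ lam 1 < 1)) ∧
    (SymTensor.StronglyPolynomiallyTractable
        (fun ε d => SymTensor.absoluteComplexity 𝒜 (SymTensor.antisymmetricProblem S d) ε) ↔
      SymTensor.InSomeLp lam) := by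
  open SymTensor in
  obtain ⟨u, b, σ, j₀, j₁, hσ, hσlam, hS', hne, hj₀, hj₁, hle₀, hle₁, hsum⟩ :=
    hlam.exists_basis_bounds hlam₂
  have hlam₀ : 0 < lam 0 := hlam₂.trans_le (hlam.antitone zero_le_one)
  have hupper : ∀ a : ℝ, lam 0 ≤ a → lam 1 < a → InSomeLp lam →
      ∃ C p : ℝ, 0 < C ∧ 0 < p ∧ ∀ d (ε : ℝ), 0 < ε → ∃ n : ℕ, (n : ℝ) ≤ C * ε ^ (-p) ∧
        minimalError 𝒜 (symmetricProblem S d) n ≤ ENNReal.ofReal (ε * √(a ^ d)) := by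
    intro a h0 h1 hLp
    have ha := hlam₀.trans_le h0
    obtain ⟨τ, hτ, hs⟩ := hLp.exists_summable
    have hs' := hsum τ hτ hs
    obtain ⟨τ', hτ', hT⟩ := exists_exponent_sum_le (y := fun j => ‖S (b j)‖ ^ 2 / a)
      (fun j => by positivity) hτ
      ((hs'.div_const (a ^ τ)).congr fun j => (Real.div_rpow (sq_nonneg _) ha.le τ).symm) j₀
      ((div_lt_one ha).2 h1) (by positivity) fun j hj => div_le_div_of_nonneg_right (hle₁ j hj) ha.le
    exact ⟨Real.exp 1, 2 * τ', Real.exp_pos 1, by positivity, fun d ε hε =>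
      exists_minimalError_symmetricProblem_le 𝒜 b S hS' ha hτ hs' j₀ (fun j => (hle₀ j).trans h0)
        hτ' hT d hε⟩
  -- For `d = 1` the only permutation is the identity, so every tensor is both symmetric and
  -- antisymmetric.
  have hlowerSym : ∀ n, ENNReal.ofReal √(lam n) ≤ minimalError 𝒜 (symmetricProblem S 1) n :=
    fun n => ofReal_sqrt_le_minimalError_one 𝒜 b S hS' (symmetricSubspace 𝕜 H 1) (fun k π => by
      rw [permute_tensorBasis, Subsingleton.elim π 1, Equiv.Perm.coe_one, Function.comp_id]) hlam.antitone hσ hσlam n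
  have hlowerAnti : ∀ n, ENNReal.ofReal √(lam n) ≤ minimalError 𝒜 (antisymmetricProblem S 1) n :=
    fun n => ofReal_sqrt_le_minimalError_one 𝒜 b S hS' (antisymmetricSubspace 𝕜 H 1) (fun k π => by
      rw [permute_tensorBasis, Subsingleton.elim π 1]
      simp) hlam.antitone hσ hσlam n
  refine ⟨⟨fun h => ⟨?_, ?_⟩, fun ⟨hLp, hlt⟩ => ?_⟩, fun h1 => ⟨fun h => ⟨?_, ?_⟩,
    fun ⟨hLp, hlt⟩ => ?_⟩, fun h => ?_, fun hLp => ?_⟩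
  · obtain ⟨C, p, hC, hp, h⟩ := h.exists_minimalError_le
    refine inSomeLp_of_sqrt_le (κ := √(lam 0)) hlam.antitone hlam.nonneg hC hp fun ε hε hε1 => ?_
    obtain ⟨n, hn, hn'⟩ := h 1 le_rfl ε hε hε1
    refine ⟨n, hn, ?_⟩
    have h2 := (hlowerSym n).trans (hn'.trans (mul_le_mul_right
      (minimalError_symmetricProblem_zero_le 𝒜 b S hS' hlam₀.le hle₀ 1) _))
    rw [← ENNReal.ofReal_mul hε.le, ENNReal.ofReal_le_ofReal_iff (by positivity), pow_one,
      mul_comm] at h2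
    exact h2
  · by_contra! hge
    have heq : lam 1 = lam 0 := le_antisymm (hlam.antitone zero_le_one) hge
    refine not_stronglyPolynomiallyTractable (r := fun d => √(lam 0 ^ d))
      (fun d => Real.sqrt_pos.2 (pow_pos hlam₀ d)) (fun d => ?_) (fun d n hn => ?_) h
    · rw [ENNReal.ofReal_mul (by norm_num)]
      exact mul_le_mul_right
        (minimalError_symmetricProblem_zero_le 𝒜 b S hS' hlam₀.le hle₀ d) _
    · exact ofReal_sqrt_pow_le_minimalError_symmetricProblem 𝒜 b S hS' hne hj₀ (hj₁.trans heq) hn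
  · obtain ⟨C, p, hC, hp, hu⟩ := hupper (lam 0) le_rfl hlt hLp
    refine stronglyPolynomiallyTractable_of_minimalError_le hC hp fun d ε hε => ?_
    obtain ⟨n, hn, hn'⟩ := hu d ε hε
    refine ⟨n, hn, hn'.trans ?_⟩
    rw [ENNReal.ofReal_mul hε.le, ← hj₀]
    exact mul_le_mul_right (ofReal_sqrt_pow_le_minimalError_zero 𝒜 b S hS' j₀ d) _
  · obtain ⟨C, p, hC, hp, h⟩ := h.exists_minimalError_le
    refine inSomeLp_of_sqrt_le (κ := 1) hlam.antitone hlam.nonneg hC hp fun ε hε hε1 => ?_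
    obtain ⟨n, hn, hn'⟩ := h 1 le_rfl ε hε hε1
    refine ⟨n, hn, ?_⟩
    rw [one_mul]
    exact (ENNReal.ofReal_le_ofReal_iff hε.le).1 ((hlowerSym n).trans hn')
  -- With `lam 0 ≤ 1`, failure of `lam 1 < 1` forces `lam 0 = lam 1 = 1`, and the first `d`
  -- functionals do not bring the error below `1`.
  · by_contra! hge
    have h0 : lam 0 = 1 := le_antisymm h1 (hge.trans (hlam.antitone zero_le_one))
    have h1' : lam 1 = 1 := le_antisymm ((hlam.antitone zero_le_one).trans h1) hge
    refine not_stronglyPolynomiallyTractable (r := fun _ => 1) (fun _ => one_pos)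
      (fun d => by rw [mul_one]) (fun d n hn => ?_) h
    have := ofReal_sqrt_pow_le_minimalError_symmetricProblem 𝒜 b S hS' hne (hj₀.trans h0)
      (hj₁.trans h1') hn
    simpa using this
  · obtain ⟨C, p, hC, hp, hu⟩ := hupper 1 h1 hlt hLp
    refine stronglyPolynomiallyTractable_of_minimalError_le hC hp fun d ε hε => ?_
    simpa using hu d ε hε
  · obtain ⟨C, p, hC, hp, h⟩ := h.exists_minimalError_le
    refine inSomeLp_of_sqrt_le (κ := 1) hlam.antitone hlam.nonneg hC hp fun ε hε hε1 => ?_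
    obtain ⟨n, hn, hn'⟩ := h 1 le_rfl ε hε hε1
    refine ⟨n, hn, ?_⟩
    rw [one_mul]
    exact (ENNReal.ofReal_le_ofReal_iff hε.le).1 ((hlowerAnti n).trans hn')
  · obtain ⟨τ, hτ, hs⟩ := hLp.exists_summable
    exact stronglyPolynomiallyTractable_of_minimalError_le (Real.exp_pos _)
      (mul_pos two_pos hτ) fun d ε hε => exists_minimalError_antisymmetricProblem_le 𝒜 b S hS'
        hτ (hsum τ hτ hs) hle₀ d hε
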